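/- Consider $n$ grid-forming converters at buses $1,\dots,n$ joined by lines with uniform resistance–inductance ratio $\rho>0$ and susceptances $b_{ij}=b_{ji}\ge 0$ ($b_{ij}=0$ if there is no line). Let $\omega_0>0$ be the nominal frequency, let $|v|_{0,i}>0$ be the steady-state voltage magnitudes (per unit), and let $|v|_{\max}$ satisfy $|v|_{0,i}\le |v|_{\max}\le 1.1$ for all $i$. The device dynamics are $\mathcal D_0(s)=\mathrm{diag}(D_1(s),\dots,D_n(s))$ with $$D_i(s)=\mathrm{diag}\Big(\tfrac{d_{p,i}}{\tau_{p,i}s+1},\tfrac{d_{q,i}}{\tau_{q,i}s+1}\Big),\qquad d_{p,i},d_{q,i}>0,\ \ \tau_{p,i},\tau_{q,i}\ge 0 .$$ The network dynamics are $\mathcal N_0(s)=N(s)\,\mathrm{diag}\big(\tfrac1s,\tfrac1{|v|_{0,1}},\dots,\tfrac1s,\tfrac1{|v|_{0,n}}\big)$, where $N(s)$ has the $2\times2$ blocks $$N_{ii}(s)=\sum_{j\ne i}\frac{b_{ij}|v|_{0,i}^2}{1+(\rho+\frac{s}{\omega_0})^2}\begin{bmatrix}1&\frac{s}{\omega_0}\\-\frac{s}{\omega_0}&1\end{bmatrix}+\sum_{j\ne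 i}b_{ij}\frac{|v|_{0,i}^2-|v|_{0,i}|v|_{0,j}}{1+\rho^2}\begin{bmatrix}-1&0\\0&1\end{bmatrix},$$ $$N_{ij}(s)=\frac{b_{ij}|v|_{0,i}|v|_{0,j}}{1+(\rho+\frac{s}{\omega_0})^2}\begin{bmatrix}-1&-\frac{s}{\omega_0}\\\frac{s}{\omega_0}&-1\end{bmatrix}\quad(i\ne j).$$ For each $i$ put $$\alpha_p=\tfrac{d_{p,i}}{\omega_0}|v|_{\max}^2\sum_{j\ne i}b_{ij},\quad \tilde\tau_p=\tau_{p,i}\omega_0,\quad \alpha_q=\tfrac{d_{q,i}}{|v|_{0,i}}\sum_{j\ne i}b_{ij},\quad \tilde\tau_q=\tau_{q,i}\omega_0 ,$$ and assume, for each $i$, $$\alpha_p<\tfrac{1+\rho^2}{5+2\rho^2}\big(2\rho+\tilde\tau_p(1+\rho^2)\big),\qquad \alpha_p<\tfrac{(1+\rho^2)^2}{6\rho},$$ $$\alpha_p<2\rho(1+\rho^2)\,\frac{\tilde\tau_p(\tilde\tau_p(1+\rho^2)+2\rho)+1}{4\tilde\tau_p\rho(1+\rho^2)+2\rho^2+5},\qquad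 \alpha_p<\frac{(2\rho^2-5)+\sqrt{(5-2\rho^2)^2+16\rho^2}}{4\rho},$$ and $$\alpha_q<\tfrac54(1+\rho^2),\qquad \alpha_q<\frac{(1+\rho^2)\,2\rho\tilde\tau_q}{(2\rho^2+5)|v|_{\max}^2},\qquad \alpha_q<\frac{(1+\rho^2)^2\,\tilde\tau_q}{6\rho|v|_{\max}^2},$$ $$0<-2\rho|v|_{\max}^4\,\alpha_q^2+|v|_{\max}^2(2\rho^2-5)\,\alpha_q\tilde\tau_q+2\rho\,\tilde\tau_q^2 .$$ Then the negative feedback interconnection $\mathcal D_0\#\mathcal N_0$ is internally feedback stable: $\mathcal D_0$ and $\mathcal N_0$ are proper, $I+\mathcal D_0\mathcal N_0$ is invertible, and the closed-loop transfer matrix $$\mathcal D_0\#\mathcal N_0=\begin{bmatrix}(I+\mathcal D_0\mathcal N_0)^{-1}\mathcal D_0&-(I+\mathcal D_0\mathcal N_0)^{-1}\mathcal D_0\mathcal N_0\\ \mathcal N_0(I+\mathcal D_0\mathcal N_0)^{-1}\mathcal D_0&\mathcal N_0(I+\mathcal D_0\mathcal N_0)^{-1}\end{bmatrix}$$ lies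 in $\mathcal{RH}_\infty^{4n\times4n}$, i.e. its entries are proper real rational functions all of whose poles are in the open left half plane. -/

import Mathlib

/-! ## Real rational transfer matrices and internal feedback stability

A transfer function is an element of `RatFunc ℝ`, with `RatFunc.X` as the Laplace variable `s`.
`RatFunc.num` and `RatFunc.denom` are coprime, so the poles are the complex zeros of `denom`. -/

namespace GridForming

noncomputable section

/-- A real rational function is proper if it has a finite limit at infinity. -/
def IsProper (f : RatFunc ℝ) : Prop :=
  f.num.natDegree ≤ f.denom.natDegree

/-- All poles lie in the open left half plane. -/
def HasStablePoles (f : RatFunc ℝ) : Prop :=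
  ∀ s : ℂ, Polynomial.aeval s f.denom = 0 → s.re < 0

/-- A transfer matrix is proper if all its entries are. -/
def IsProperMatrix {ι κ : Type*} (H : Matrix ι κ (RatFunc ℝ)) : Prop :=
  ∀ i j, IsProper (H i j)

/-- The space `RH∞` of real rational proper transfer matrices all of whose poles lie in the open
left half plane. -/
def RHInf (ι κ : Type*) : Set (Matrix ι κ (RatFunc ℝ)) :=
  {H | ∀ i j, IsProper (H i j) ∧ HasStablePoles (H i j)}

/-- The closed-loop transfer matrix `H₁ # H₂` from `(w₁, w₂)` to `(y₁, y₂)` of the negative feedback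
interconnection `y₁ = H₁ (w₁ - y₂)`, `y₂ = H₂ (y₁ + w₂)`. -/
def closedLoop {ι : Type*} [Fintype ι] [DecidableEq ι] (H₁ H₂ : Matrix ι ι (RatFunc ℝ)) :
    Matrix (ι ⊕ ι) (ι ⊕ ι) (RatFunc ℝ) :=
  Matrix.fromBlocks
    ((1 + H₁ * H₂)⁻¹ * H₁) (-((1 + H₁ * H₂)⁻¹ * H₁ * H₂))
    (H₂ * (1 + H₁ * H₂)⁻¹ * H₁) (H₂ * (1 + H₁ * H₂)⁻¹)

/-- Internal feedback stability of the interconnection of two proper real rational transfer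
matrices: `I + H₁ H₂` is invertible and all four closed-loop transfer matrices are stable.
The properness of `H₁`, `H₂` and the invertibility are part of the definition, so that the inverse
in `closedLoop` is the true one. -/
structure InternallyFeedbackStable {ι : Type*} [Fintype ι] [DecidableEq ι]
    (H₁ H₂ : Matrix ι ι (RatFunc ℝ)) : Prop where
  proper₁ : IsProperMatrix H₁
  proper₂ : IsProperMatrix H₂
  isUnit_det : IsUnit (1 + H₁ * H₂).det
  stable : closedLoop H₁ H₂ ∈ RHInf (ι ⊕ ι) (ι ⊕ ι)

/-! ## Converter and network dynamics

Vectors of length `2n` are indexed by `Fin n × Fin 2`: bus first, then `0` for the active power /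
frequency / angle channel and `1` for the reactive power / voltage channel. -/

/-- The droop controller `diag(d_p / (τ_p s + 1), d_q / (τ_q s + 1))` of one converter. -/
def converterBlock (dp dq τp τq : ℝ) : Matrix (Fin 2) (Fin 2) (RatFunc ℝ) :=
  !![RatFunc.C dp / (RatFunc.C τp * RatFunc.X + 1), 0;
     0, RatFunc.C dq / (RatFunc.C τq * RatFunc.X + 1)]

/-- The device dynamics `D₀(s) = D(s) = diag(D₁(s), …, Dₙ(s))`. -/
def deviceDynamics {n : ℕ} (dp dq τp τq : Fin n → ℝ) :
    Matrix (Fin n × Fin 2) (Fin n × Fin 2) (RatFunc ℝ) :=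
  Matrix.comp (Fin n) (Fin n) (Fin 2) (Fin 2) (RatFunc ℝ)
    (Matrix.diagonal fun i => converterBlock (dp i) (dq i) (τp i) (τq i))

/-- The scalar line dynamics `1 / (1 + (ρ + s/ω₀)²)`. -/
def lineGain (ω₀ ρ : ℝ) : RatFunc ℝ :=
  1 / (1 + (RatFunc.C ρ + RatFunc.X / RatFunc.C ω₀) ^ 2)

/-- The matrix `[1, s/ω₀; -s/ω₀, 1]`. -/
def lineMatrix (ω₀ : ℝ) : Matrix (Fin 2) (Fin 2) (RatFunc ℝ) :=
  !![1, RatFunc.X / RatFunc.C ω₀; -(RatFunc.X / RatFunc.C ω₀), 1]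

/-- The self-susceptance `∑_{j ≠ i} b_ij` of bus `i`. -/
def selfSusceptance {n : ℕ} (b : Fin n → Fin n → ℝ) (i : Fin n) : ℝ :=
  ∑ j ∈ Finset.univ.erase i, b i j

/-- The `2 × 2` blocks `N_ij(s)` of the dynamic small-signal network model, with line susceptances
`b i j` and steady-state voltage magnitudes `v i`. -/
def networkBlock {n : ℕ} (ω₀ ρ : ℝ) (b : Fin n → Fin n → ℝ) (v : Fin n → ℝ) (i j : Fin n) :
    Matrix (Fin 2) (Fin 2) (RatFunc ℝ) :=
  if i = j then
    (∑ k ∈ Finset.univ.erase i,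
      (RatFunc.C (b i k * v i ^ 2) * lineGain ω₀ ρ) • lineMatrix ω₀) +
    ∑ k ∈ Finset.univ.erase i,
      RatFunc.C (b i k * ((v i ^ 2 - v i * v k) / (1 + ρ ^ 2))) •
        (!![-1, 0; 0, 1] : Matrix (Fin 2) (Fin 2) (RatFunc ℝ))
  else
    -((RatFunc.C (b i j * (v i * v j)) * lineGain ω₀ ρ) • lineMatrix ω₀)

/-- The network model `N(s)`, from angles and normalized voltage magnitudes to powers. -/
def networkModel {n : ℕ} (ω₀ ρ : ℝ) (b : Fin n → Fin n → ℝ) (v : Fin n → ℝ) :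
    Matrix (Fin n × Fin 2) (Fin n × Fin 2) (RatFunc ℝ) :=
  Matrix.comp (Fin n) (Fin n) (Fin 2) (Fin 2) (RatFunc ℝ)
    (Matrix.of fun i j => networkBlock ω₀ ρ b v i j)

/-- The network dynamics `N₀(s) = N(s) · diag(1/s, 1/v₁, …, 1/s, 1/vₙ)`, from frequencies and
voltage magnitudes to powers. -/
def networkDynamics {n : ℕ} (ω₀ ρ : ℝ) (b : Fin n → Fin n → ℝ) (v : Fin n → ℝ) :
    Matrix (Fin n × Fin 2) (Fin n × Fin 2) (RatFunc ℝ) :=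
  networkModel ω₀ ρ b v *
    Matrix.diagonal fun x => ![1 / RatFunc.X, 1 / RatFunc.C (v x.1)] x.2

/-! ## Decentralized stability conditions -/

/-- Constants depending on `ρ`. -/
def c₁ (ρ : ℝ) : ℝ := (1 + ρ ^ 2) / (5 + 2 * ρ ^ 2)

def c₂ (ρ : ℝ) : ℝ := (1 + ρ ^ 2) ^ 2 / (6 * ρ)

def c₃ (ρ : ℝ) : ℝ := 2 * ρ * (1 + ρ ^ 2)

def c₄ (ρ : ℝ) : ℝ :=
  ((2 * ρ ^ 2 - 5) + Real.sqrt ((5 - 2 * ρ ^ 2) ^ 2 + 16 * ρ ^ 2)) / (4 * ρ)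

def c₅ (ρ : ℝ) : ℝ := 5 * (1 + ρ ^ 2) / 4

def c₆ (ρ vmax : ℝ) : ℝ := (1 + ρ ^ 2) / (2 * ρ ^ 2 * vmax ^ 2 + 5 * vmax ^ 2)

def c₇ (ρ vmax : ℝ) : ℝ := (ρ ^ 2 + 1) ^ 2 / (6 * ρ * vmax ^ 2)

def c₈ (ρ vmax : ℝ) : ℝ := -2 * ρ * vmax ^ 4

def c₉ (ρ vmax : ℝ) : ℝ := vmax ^ 2 * (2 * ρ ^ 2 - 5)

/-- The conditions on the active power-frequency droop control, in terms of
`α = α_p` and `τ = τ̃_p`. -/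
structure ActivePowerConditions (ρ α τ : ℝ) : Prop where
  cond₁ : α < c₁ ρ * (2 * ρ + τ * (1 + ρ ^ 2))
  cond₂ : α < c₂ ρ
  cond₃ : α < c₃ ρ * ((τ * (τ * (1 + ρ ^ 2) + 2 * ρ) + 1) /
    (4 * τ * ρ * (1 + ρ ^ 2) + 2 * ρ ^ 2 + 5))
  cond₄ : α < c₄ ρ

/-- The conditions on the reactive power-voltage droop control, in terms of
`α = α_q` and `τ = τ̃_q`. -/
structure ReactivePowerConditions (ρ vmax α τ : ℝ) : Prop where
  cond₁ : α < c₅ ρ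
  cond₂ : α < c₆ ρ vmax * (2 * ρ * τ)
  cond₃ : α < c₇ ρ vmax * τ
  cond₄ : 0 < α ^ 2 * c₈ ρ vmax + α * τ * c₉ ρ vmax + 2 * τ ^ 2 * ρ

end

end GridForming

/-! Write Δ for the inverse of the device dynamics D, a diagonal polynomial matrix, N for the
network dynamics, and T = (Δ + N)⁻¹. The four closed-loop blocks are T, TΔ - 1, 1 - ΔT and (1 -
ΔT)Δ, so stability reduces to the poles of T. Properness is a separate matter: DN is strictly
proper, and then 1 + DN is invertible over the proper rational functions
(`isProperMatrix_one_add_inv`).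

The poles of T are excluded by an energy estimate in the open right half plane. Let y be a column of
T at s, σ = s/ω₀, p_i = y_(i,0), q_i = s y_(i,1)/v_i. The equation for y is multiplied by ω₀, paired
with (p, q), and its real part is taken. Up to a nonnegative term, the devices contribute ∑
(ω₀/d_p)|p|² + (v/d_q)(τ̃_q + Re(1/σ))|q|².

In the network term, subtracting the static value of the line gain leaves A·g(σ) + β·i/(1 + (ρ+σ)²),
where A is a Dirichlet energy, β a symplectic pairing with |β| ≤ A, and g a scalar function. This is
a combination of the two functions `edgeTransfer ρ (±1)` with nonnegative weights (A ± β)/2. Their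
real parts are bounded below on the imaginary axis by an explicit ratio, and Phragmén–Lindelöf
carries the bound to the half plane (`neg_le_edgeTransfer_re`). The static remainder can be negative
only in the voltages, by a controlled amount (`static_form_lower_bound`). Together they give
`network_form_lower_bound`.

The droop conditions say that the devices outweigh these losses with a uniform margin
(`exists_margins`). Hence |y|√t stays bounded at s = s₀ + t as t → 0⁺ whenever Re s₀ ≥ 0
(`exists_response_bound`), whereas a pole at s₀ would force growth at least like 1/t
(`denom_ne_zero_of_bound`). -/

namespace GridForming

open Filter Topology Finset

/-! ### The scalar line dynamics in the right half plane -/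

lemma lineDenom_eq (ρ : ℝ) (σ : ℂ) :
    1 + ((ρ : ℂ) + σ) ^ 2 = (ρ + σ + Complex.I) * (ρ + σ - Complex.I) := by
  linear_combination Complex.I_sq

lemma le_norm_add_I {ρ : ℝ} {σ : ℂ} (hσ : 0 ≤ σ.re) :
    ρ ≤ ‖(ρ : ℂ) + σ + Complex.I‖ := by
  refine le_trans ?_ (Complex.re_le_norm _)
  simpa using hσ

lemma le_norm_sub_I {ρ : ℝ} {σ : ℂ} (hσ : 0 ≤ σ.re) :
    ρ ≤ ‖(ρ : ℂ) + σ - Complex.I‖ := by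
  refine le_trans ?_ (Complex.re_le_norm _)
  simpa using hσ

lemma lineDenom_ne_zero {ρ : ℝ} (hρ : 0 < ρ) {σ : ℂ} (hσ : 0 ≤ σ.re) :
    1 + ((ρ : ℂ) + σ) ^ 2 ≠ 0 := by
  rw [lineDenom_eq]
  exact mul_ne_zero (norm_pos_iff.1 (hρ.trans_le (le_norm_add_I hσ)))
    (norm_pos_iff.1 (hρ.trans_le (le_norm_sub_I hσ)))

/-- `|1 + (ρ + i w)²|²`. -/
def lineDenomSq (ρ w : ℝ) : ℝ := (1 + ρ ^ 2 - w ^ 2) ^ 2 + 4 * ρ ^ 2 * w ^ 2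

lemma lineDenomSq_pos {ρ : ℝ} (hρ : 0 < ρ) (w : ℝ) : 0 < lineDenomSq ρ w := by
  unfold lineDenomSq
  rcases eq_or_ne w 0 with rfl | hw
  · simp only [ne_eq, OfNat.ofNat_ne_zero, not_false_eq_true, zero_pow, sub_zero, mul_zero, add_zero]
    positivity
  · have : 0 < 4 * ρ ^ 2 * w ^ 2 := by positivity
    have := sq_nonneg (1 + ρ ^ 2 - w ^ 2)
    linarith

/-- The frequency-dependent part of an edge of the network, `ε = ±1` being the two circular
components. -/
noncomputable def edgeTransfer (ρ ε : ℝ) (σ : ℂ) : ℂ :=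
  (-(2 * ρ + σ) / (1 + ρ ^ 2) + ε * Complex.I) / (1 + (ρ + σ) ^ 2)

/-- After multiplying by the conjugate denominator the w² terms cancel, so the numerator is only
linear in w. -/
lemma edgeTransfer_re_axis {ρ : ℝ} (hρ : 0 < ρ) (ε w : ℝ) :
    (edgeTransfer ρ ε (w * Complex.I)).re = -(2 * ρ * (1 - ε * w)) / lineDenomSq ρ w := by
  have hd := lineDenomSq_pos hρ w
  have h1 : (1 : ℝ) + ρ ^ 2 ≠ 0 := by positivity
  have e1 : (1 : ℂ) + (ρ + w * Complex.I) ^ 2 =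
      ((1 + ρ ^ 2 - w ^ 2 : ℝ) : ℂ) + ((2 * ρ * w : ℝ) : ℂ) * Complex.I := by
    push_cast
    linear_combination (w : ℂ) ^ 2 * Complex.I_sq
  have e2 : -(2 * (ρ : ℂ) + w * Complex.I) / (1 + ρ ^ 2) + ε * Complex.I =
      ((-(2 * ρ) / (1 + ρ ^ 2) : ℝ) : ℂ) + ((ε - w / (1 + ρ ^ 2) : ℝ) : ℂ) * Complex.I := by
    push_cast
    ring
  rw [edgeTransfer, e1, e2, Complex.div_re]
  have hn : Complex.normSq (((1 + ρ ^ 2 - w ^ 2 : ℝ) : ℂ) + ((2 * ρ * w : ℝ) : ℂ) * Complex.I)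
      = lineDenomSq ρ w := by
    rw [Complex.normSq_add_mul_I, lineDenomSq]; ring
  have hre (a b : ℝ) : ((a : ℂ) + b * Complex.I).re = a := by simp
  have him (a b : ℝ) : ((a : ℂ) + b * Complex.I).im = b := by simp
  rw [hn, hre, hre, him, him]
  field_simp
  ring

/-- Supplies the growth hypotheses of Phragmén–Lindelöf; only the finiteness of the bound matters.
-/
lemma edgeTransfer_norm_le {ρ : ℝ} (hρ : 0 < ρ) {ε : ℝ} (hε : |ε| ≤ 1) {σ : ℂ}
    (hσ : 0 ≤ σ.re) :
    ‖edgeTransfer ρ ε σ‖ ≤ 1 / ρ + (2 + ρ) / ρ ^ 2 := by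
  set u := (ρ : ℂ) + σ + Complex.I with hu
  set u' := (ρ : ℂ) + σ - Complex.I with hu'
  have h1 : ρ ≤ ‖u‖ := le_norm_add_I hσ
  have h2 : ρ ≤ ‖u'‖ := le_norm_sub_I hσ
  have hp : 0 < ‖u‖ * ‖u'‖ := mul_pos (hρ.trans_le h1) (hρ.trans_le h2)
  rw [edgeTransfer, lineDenom_eq, norm_div, norm_mul, div_le_iff₀ hp]
  have h3 : ‖-(2 * (ρ : ℂ) + σ) / (1 + ρ ^ 2)‖ ≤ ‖u'‖ + 1 + ρ := by
    have e : ‖(1 : ℂ) + ρ ^ 2‖ = 1 + ρ ^ 2 := by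
      have : (1 : ℂ) + ρ ^ 2 = ((1 + ρ ^ 2 : ℝ) : ℂ) := by push_cast; rfl
      rw [this, Complex.norm_real, Real.norm_of_nonneg (by positivity)]
    rw [norm_div, norm_neg, e]
    refine (div_le_self (norm_nonneg _) (by nlinarith)).trans ?_
    have : 2 * (ρ : ℂ) + σ = u' + Complex.I + ρ := by rw [hu']; ring
    rw [this]
    refine (norm_add₃_le).trans ?_
    simp [abs_of_pos hρ]
  have h4 : ‖(ε : ℂ) * Complex.I‖ ≤ 1 := by simpa using hε
  refine (norm_add_le _ _).trans ((add_le_add h3 h4).trans ?_)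
  have e : (1 / ρ + (2 + ρ) / ρ ^ 2) * (‖u‖ * ‖u'‖) =
      (‖u‖ / ρ) * ‖u'‖ + (2 + ρ) * ((‖u‖ / ρ) * (‖u'‖ / ρ)) := by field_simp
  rw [e]
  have k1 : 1 ≤ ‖u‖ / ρ := (one_le_div hρ).2 h1
  have k2 : 1 ≤ ‖u'‖ / ρ := (one_le_div hρ).2 h2
  have k3 : 1 ≤ (‖u‖ / ρ) * (‖u'‖ / ρ) := one_le_mul_of_one_le_of_one_le k1 k2
  nlinarith [norm_nonneg u']

/-- A lower bound of the real part of the edge dynamics on the imaginary axis extends to the right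
half plane, by the Phragmen-Lindelöf principle. -/
lemma neg_le_edgeTransfer_re {ρ c ε : ℝ} (hρ : 0 < ρ) (hε : |ε| ≤ 1)
    (hc : ∀ w : ℝ, 2 * ρ * (1 + |w|) ≤ c * lineDenomSq ρ w) {σ : ℂ} (hσ : 0 ≤ σ.re) :
    -c ≤ (edgeTransfer ρ ε σ).re := by
  have hb : ∀ z : ℂ, 0 ≤ z.re →
      ‖Complex.exp (-edgeTransfer ρ ε z)‖ ≤ Real.exp (1 / ρ + (2 + ρ) / ρ ^ 2) := by
    intro z hz
    rw [Complex.norm_exp, Real.exp_le_exp, Complex.neg_re]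
    exact (neg_le_abs _).trans ((Complex.abs_re_le_norm _).trans (edgeTransfer_norm_le hρ hε hz))
  -- The modulus of exp(-f) is exp(-Re f), so a lower bound on Re f becomes an upper bound on a
  -- modulus. The exponential is bounded, hence the zero growth parameters.
  have key : ‖Complex.exp (-edgeTransfer ρ ε σ)‖ ≤ Real.exp c := by
    refine PhragmenLindelof.right_half_plane_of_bounded_on_real
      (f := fun z => Complex.exp (-edgeTransfer ρ ε z)) ?_ ⟨0, two_pos, 0, ?_⟩ ?_ ?_ hσ
    · refine DifferentiableOn.diffContOnCl fun z hz => ?_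
      rw [Complex.closure_setOfPred_lt_re] at hz
      have h0 := lineDenom_ne_zero hρ (σ := z) hz
      refine DifferentiableAt.differentiableWithinAt ?_
      unfold edgeTransfer
      fun_prop (disch := assumption)
    · refine Asymptotics.IsBigO.of_bound (Real.exp (1 / ρ + (2 + ρ) / ρ ^ 2)) ?_
      refine eventually_inf_principal.2 (Eventually.of_forall fun z hz => ?_)
      simpa using hb z (le_of_lt hz)
    · refine ⟨Real.exp (1 / ρ + (2 + ρ) / ρ ^ 2), eventually_map.2 ?_⟩
      filter_upwards [eventually_ge_atTop 0] with x hx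
      exact hb x (by simpa using hx)
    · intro w
      rw [Complex.norm_exp, Real.exp_le_exp, Complex.neg_re, edgeTransfer_re_axis hρ, neg_div,
        neg_neg, div_le_iff₀ (lineDenomSq_pos hρ w)]
      refine le_trans ?_ (hc w)
      have : -(ε * w) ≤ |w| := by
        refine (neg_le_abs _).trans ?_
        rw [abs_mul]
        exact mul_le_of_le_one_left (abs_nonneg _) hε
      nlinarith
  rw [Complex.norm_exp, Real.exp_le_exp, Complex.neg_re] at key
  linarith

/-! ### Consequences of the decentralized conditions -/

/-- With α = β/τ and 2|w| ≤ 1 + w², it suffices that the quadratic z² - 2(1 + ρα - ρ²)z + (1 + ρ²)²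
- 6ρα is positive for z = w² ≥ 0. The homogeneous form in β and τ serves both channels: τ = 1 for
active power, β = α·vmax² for reactive power. -/
lemma lineDenomSq_lower_bound {ρ τ β : ℝ} (hρ : 0 < ρ) (hτ : 0 < τ) (hβ : 0 ≤ β)
    (h₁ : 6 * ρ * β < (1 + ρ ^ 2) ^ 2 * τ)
    (h₂ : 2 * ρ * β ^ 2 + (5 - 2 * ρ ^ 2) * (β * τ) < 2 * ρ * τ ^ 2) (w : ℝ) :
    4 * ρ * β * (1 + |w|) < τ * lineDenomSq ρ w := by
  obtain ⟨α, rfl⟩ : ∃ α, β = α * τ := ⟨β / τ, by field_simp⟩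
  have hα : 0 ≤ α := nonneg_of_mul_nonneg_left hβ hτ
  replace h₁ : 6 * ρ * α < (1 + ρ ^ 2) ^ 2 := by
    refine lt_of_mul_lt_mul_right ?_ hτ.le
    linarith
  replace h₂ : 2 * ρ * α ^ 2 + (5 - 2 * ρ ^ 2) * α < 2 * ρ := by
    refine lt_of_mul_lt_mul_right ?_ (sq_nonneg τ)
    linarith
  suffices h : 4 * ρ * α * (1 + |w|) < lineDenomSq ρ w by
    have := mul_lt_mul_of_pos_left h hτ
    linarith
  have hw : 2 * |w| ≤ 1 + w ^ 2 := by nlinarith [sq_nonneg (|w| - 1), sq_abs w]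
  have h3 : 4 * ρ * α * (1 + |w|) ≤ 6 * ρ * α + 2 * ρ * α * w ^ 2 := by
    have : 0 ≤ ρ * α := by positivity
    nlinarith
  refine h3.trans_lt ?_
  unfold lineDenomSq
  set z := w ^ 2
  have hz : 0 ≤ z := sq_nonneg w
  -- The vertex of the quadratic is at 1 + ρα - ρ². If it is not positive, the constant term
  -- decides, by `h₁`; otherwise the discriminant must be negative, which is `hd`.
  rcases le_or_gt (ρ * α) (ρ ^ 2 - 1) with h | h
  · nlinarith [mul_nonneg (sub_nonneg.2 h) hz]
  · have hd : ρ * (ρ * α ^ 2 + (8 - 2 * ρ ^ 2) * α) < ρ * (4 * ρ) := by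
      refine mul_lt_mul_of_pos_left ?_ hρ
      nlinarith [mul_nonneg hα (sub_nonneg.2 h.le), mul_nonneg hρ.le (sq_nonneg α)]
    nlinarith [sq_nonneg (z - (1 + ρ * α - ρ ^ 2))]

lemma ActivePowerConditions.lt_lineDenomSq {ρ α τ : ℝ} (h : ActivePowerConditions ρ α τ)
    (hρ : 0 < ρ) (hα : 0 ≤ α) (w : ℝ) : 4 * ρ * α * (1 + |w|) < lineDenomSq ρ w := by
  have h₁ := h.cond₂
  have h₂ := h.cond₄
  rw [c₂, lt_div_iff₀ (by positivity)] at h₁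
  rw [c₄, lt_div_iff₀ (by positivity)] at h₂
  have h₃ : 2 * ρ * α ^ 2 + (5 - 2 * ρ ^ 2) * α < 2 * ρ := by
    -- `c₄` is the positive root of 2ρα² + (5 - 2ρ²)α - 2ρ. Squaring the inequality with the root
    -- needs a nonnegative left side; when it is negative, the first two terms of the quadratic
    -- already sum to at most 0.
    rcases lt_or_ge (α * (4 * ρ) - (2 * ρ ^ 2 - 5)) 0 with h | h
    · have : α * (2 * ρ * α - (2 * ρ ^ 2 - 5)) ≤ 0 :=
        mul_nonpos_of_nonneg_of_nonpos hα (by nlinarith [mul_nonneg hα hρ.le])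
      nlinarith
    · have h4 := (Real.lt_sqrt h).1 (show _ < √((5 - 2 * ρ ^ 2) ^ 2 + 16 * ρ ^ 2) by linarith)
      refine lt_of_mul_lt_mul_left ?_ (show 0 ≤ 8 * ρ by positivity)
      nlinarith
  simpa using lineDenomSq_lower_bound hρ one_pos hα (by linarith) (by linarith) w

lemma ReactivePowerConditions.time_constant_pos {ρ vmax α τ : ℝ}
    (h : ReactivePowerConditions ρ vmax α τ) (hρ : 0 < ρ) (hv : 0 < vmax) (hα : 0 ≤ α) :
    0 < τ := by
  have h₁ := hα.trans_lt h.cond₃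
  rw [c₇] at h₁
  exact pos_of_mul_pos_right h₁ (by positivity)

lemma ReactivePowerConditions.lt_lineDenomSq {ρ vmax α τ : ℝ}
    (h : ReactivePowerConditions ρ vmax α τ) (hρ : 0 < ρ) (hv : 0 < vmax) (hα : 0 ≤ α) (w : ℝ) :
    4 * ρ * (α * vmax ^ 2) * (1 + |w|) < τ * lineDenomSq ρ w := by
  have h₁ := h.cond₃
  have h₂ := h.cond₄
  refine lineDenomSq_lower_bound hρ (h.time_constant_pos hρ hv hα) (by positivity) ?_ ?_ w
  · rw [c₇, div_mul_eq_mul_div, lt_div_iff₀ (by positivity)] at h₁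
    linarith
  · rw [c₈, c₉] at h₂
    linarith

/-- The worst case over all frequencies of the edge dynamics is attained. -/
lemma exists_edge_bound {ρ : ℝ} (hρ : 0 < ρ) :
    ∃ w₀ : ℝ, ∀ w : ℝ, 2 * ρ * (1 + |w|) ≤
      (2 * ρ * (1 + |w₀|) / lineDenomSq ρ w₀) * lineDenomSq ρ w := by
  have hcont : Continuous fun w : ℝ => 2 * ρ * (1 + |w|) / lineDenomSq ρ w := by
    refine Continuous.div (by fun_prop) (by unfold lineDenomSq; fun_prop)
      fun w => (lineDenomSq_pos hρ w).ne'
  have hfin : ∀ᶠ w in cocompact ℝ, 2 * ρ * (1 + |w|) / lineDenomSq ρ w ≤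
      2 * ρ * (1 + |(0 : ℝ)|) / lineDenomSq ρ 0 := by
    -- Beyond R, x = |w| satisfies x ≥ 4 and x ≥ 2(1 + ρ²)², enough for the quartic denominator to
    -- push the ratio below its value at 0.
    set R : ℝ := 2 * (1 + ρ ^ 2) ^ 2 + 4 with hR
    have : (Metric.closedBall (0 : ℝ) R)ᶜ ∈ cocompact ℝ :=
      (isCompact_closedBall _ _).compl_mem_cocompact
    filter_upwards [this] with w hw
    have hw : R < |w| := by simpa using hw
    rw [div_le_div_iff₀ (lineDenomSq_pos hρ w) (lineDenomSq_pos hρ 0)]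
    have h0 : lineDenomSq ρ 0 = (1 + ρ ^ 2) ^ 2 := by simp [lineDenomSq]
    rw [h0, abs_zero, add_zero, mul_one, mul_assoc]
    refine mul_le_mul_of_nonneg_left ?_ (by positivity)
    have h1 : lineDenomSq ρ w = |w| ^ 4 + (2 * ρ ^ 2 - 2) * |w| ^ 2 + (1 + ρ ^ 2) ^ 2 := by
      have : |w| ^ 4 = (|w| ^ 2) ^ 2 := by ring
      rw [lineDenomSq, this, sq_abs]; ring
    rw [h1]
    set x := |w|
    have hk : 0 ≤ (1 + ρ ^ 2) ^ 2 := by positivity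
    have hx4 : 4 ≤ x := by linarith
    have hx : 2 * (1 + ρ ^ 2) ^ 2 ≤ x := by linarith
    have a1 : (1 + x) * (1 + ρ ^ 2) ^ 2 ≤ x * x := by nlinarith
    have a2 : 16 * (x * x) ≤ x ^ 4 := by
      have : 16 ≤ x * x := by nlinarith
      nlinarith
    have a3 : 0 ≤ ρ ^ 2 * x ^ 2 := by positivity
    nlinarith
  obtain ⟨w₀, hw₀⟩ := hcont.exists_forall_ge' (x₀ := 0) hfin
  exact ⟨w₀, fun w => (div_le_iff₀ (lineDenomSq_pos hρ w)).1 (hw₀ w)⟩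

end GridForming

namespace GridForming

open Filter Topology Finset

/-! ### Weighted sums over the edges -/

section EdgeSums

variable {ι : Type*} [Fintype ι]

open ComplexConjugate

/-- Symmetrization of a weighted sum over ordered pairs. -/
lemma sum_sum_symmetrize {R : Type*} [CommSemiring R] {w : ι → ι → R}
    (hw : ∀ i j, w i j = w j i) (f : ι → ι → R) :
    2 * ∑ i, ∑ j, w i j * f i j = ∑ i, ∑ j, w i j * (f i j + f j i) := by
  have h : ∑ i, ∑ j, w i j * f i j = ∑ i, ∑ j, w i j * f j i := by
    rw [sum_comm]
    exact sum_congr rfl fun i _ => sum_congr rfl fun j _ => by rw [hw]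
  simp_rw [mul_add, sum_add_distrib]
  rw [← h, two_mul]

/-- The Dirichlet energy of a complex function on the buses. -/
noncomputable def edgeEnergy (w : ι → ι → ℝ) (a : ι → ℂ) : ℝ :=
  (∑ i, ∑ j, w i j * ‖a i - a j‖ ^ 2) / 2

/-- The symplectic pairing of two complex functions on the buses. -/
noncomputable def edgePairing (w : ι → ι → ℝ) (a b : ι → ℂ) : ℝ :=
  ∑ i, ∑ j, w i j * (conj (a i - a j) * (b i - b j)).im

variable {w : ι → ι → ℝ}

/-- Arithmetic–geometric mean inequality on each edge. It makes the weights (A ± β)/2 of the two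
circular components nonnegative. -/
lemma abs_edgePairing_le (hw : ∀ i j, 0 ≤ w i j) (a b : ι → ℂ) :
    |edgePairing w a b| ≤ edgeEnergy w a + edgeEnergy w b := by
  rw [edgeEnergy, edgeEnergy, ← add_div, ← sum_add_distrib, edgePairing, sum_div]
  refine (abs_sum_le_sum_abs _ _).trans (sum_le_sum fun i _ => ?_)
  rw [← sum_add_distrib, sum_div]
  refine (abs_sum_le_sum_abs _ _).trans (sum_le_sum fun j _ => ?_)
  rw [abs_mul, abs_of_nonneg (hw i j), ← mul_add, mul_div_assoc]
  refine mul_le_mul_of_nonneg_left ?_ (hw i j)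
  refine (Complex.abs_im_le_norm _).trans ?_
  rw [norm_mul, RCLike.norm_conj]
  nlinarith [sq_nonneg (‖a i - a j‖ - ‖b i - b j‖)]

/-- The graph Laplacian is at most twice the degree matrix, since |x - y|² ≤ 2|x|² + 2|y|². -/
lemma edgeEnergy_le (hs : ∀ i j, w i j = w j i) (hw : ∀ i j, 0 ≤ w i j) (a : ι → ℂ) :
    edgeEnergy w a ≤ 2 * ∑ i, (∑ j, w i j) * ‖a i‖ ^ 2 := by
  have h := sum_sum_symmetrize hs fun i _ => ‖a i‖ ^ 2
  simp_rw [sum_mul]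
  rw [h, edgeEnergy, sum_div]
  refine sum_le_sum fun i _ => ?_
  rw [sum_div]
  refine sum_le_sum fun j _ => ?_
  rw [mul_div_assoc]
  refine mul_le_mul_of_nonneg_left ?_ (hw i j)
  have h1 := norm_sub_le (a i) (a j)
  have h2 : ‖a i - a j‖ ^ 2 ≤ (‖a i‖ + ‖a j‖) ^ 2 := by gcongr
  nlinarith [sq_nonneg (‖a i‖ - ‖a j‖)]

/-- Summation by parts for the graph Laplacian. -/
lemma sum_conj_mul_edge (hs : ∀ i j, w i j = w j i) (a : ι → ℂ) :
    ∑ i, ∑ j, (w i j : ℂ) * (conj (a i) * (a i - a j)) = edgeEnergy w a := by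
  have h := sum_sum_symmetrize (w := fun i j => (w i j : ℂ)) (fun i j => by rw [hs])
    fun i j => conj (a i) * (a i - a j)
  have h2 : ∑ i, ∑ j, (w i j : ℂ) * (conj (a i) * (a i - a j) + conj (a j) * (a j - a i)) =
      2 * (edgeEnergy w a : ℂ) := by
    rw [edgeEnergy]
    push_cast
    rw [mul_div_cancel₀ _ two_ne_zero]
    refine sum_congr rfl fun i _ => sum_congr rfl fun j _ => ?_
    rw [← Complex.conj_mul', map_sub]
    ring
  rw [h2] at h
  exact mul_left_cancel₀ two_ne_zero h

lemma sum_conj_mul_edge_sub (hs : ∀ i j, w i j = w j i) (a b : ι → ℂ) :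
    ∑ i, ∑ j, (w i j : ℂ) * (conj (a i) * (b i - b j) - conj (b i) * (a i - a j)) =
      edgePairing w a b * Complex.I := by
  have h := sum_sum_symmetrize (w := fun i j => (w i j : ℂ)) (fun i j => by rw [hs])
    fun i j => conj (a i) * (b i - b j) - conj (b i) * (a i - a j)
  refine mul_left_cancel₀ two_ne_zero (h.trans ?_)
  rw [edgePairing]
  push_cast
  rw [sum_mul, mul_sum]
  refine sum_congr rfl fun i _ => ?_
  rw [sum_mul, mul_sum]
  refine sum_congr rfl fun j _ => ?_
  have h1 := Complex.sub_conj (conj (a i - a j) * (b i - b j))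
  simp only [map_mul, map_sub, Complex.conj_conj] at h1 ⊢
  push_cast at h1
  linear_combination (w i j : ℂ) * h1

end EdgeSums

/-! ### Coercivity of the interconnection in the right half plane -/

section Coercivity

open ComplexConjugate

variable {n : ℕ} {ρ vmax c : ℝ} {w : Fin n → Fin n → ℝ} {v : Fin n → ℝ}

/-- The static part of the network is positive semidefinite on the angles, and its indefiniteness
on the voltages is bounded. -/
lemma static_form_lower_bound (hs : ∀ i j, w i j = w j i) (hw : ∀ i j, 0 ≤ w i j)
    (hv : ∀ i, 0 < v i) (hv' : ∀ i, v i ≤ 11 / 10) (p q : Fin n → ℂ) :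
    -(4 / 5 * ∑ i, (∑ j, w i j) * ‖q i‖ ^ 2) ≤
      edgeEnergy w (fun i => v i * p i) + edgeEnergy w (fun i => v i * q i) +
        ∑ i, ∑ j, w i j * ((v i ^ 2 - v i * v j) * (‖q i‖ ^ 2 - ‖p i‖ ^ 2)) := by
  have e1 := sum_sum_symmetrize hs fun i j => (v i ^ 2 - v i * v j) * (‖q i‖ ^ 2 - ‖p i‖ ^ 2)
  have e2 := sum_sum_symmetrize hs fun i _ => ‖q i‖ ^ 2
  have e3 : 0 ≤ ∑ i, ∑ j, w i j * (‖v i * p i - v j * p j‖ ^ 2 + ‖v i * q i - v j * q j‖ ^ 2 +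
      ((v i ^ 2 - v i * v j) * (‖q i‖ ^ 2 - ‖p i‖ ^ 2) +
        (v j ^ 2 - v j * v i) * (‖q j‖ ^ 2 - ‖p j‖ ^ 2)) +
      4 / 5 * (‖q i‖ ^ 2 + ‖q j‖ ^ 2)) := by
    refine sum_nonneg fun i _ => sum_nonneg fun j _ => mul_nonneg (hw i j) ?_
    -- On one edge the angle terms collapse to v_i v_j |p_i - p_j|² ≥ 0. The voltage terms are at
    -- least (2v_i² - 2v_i v_j)|q_i|² plus the same with i and j exchanged.
    have key : ∀ z z' : ℂ, ‖v i * z - v j * z'‖ ^ 2 = v i ^ 2 * ‖z‖ ^ 2 + v j ^ 2 * ‖z'‖ ^ 2 -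
        2 * (v i * v j) * (conj z * z').re ∧ 2 * (conj z * z').re ≤ ‖z‖ ^ 2 + ‖z'‖ ^ 2 := by
      intro z z'
      simp only [← Complex.normSq_eq_norm_sq, Complex.normSq_apply, Complex.mul_re, Complex.sub_re,
        Complex.sub_im, Complex.mul_im, Complex.ofReal_re, Complex.ofReal_im, Complex.conj_re,
        Complex.conj_im]
      exact ⟨by ring, by nlinarith [sq_nonneg (z.re - z'.re), sq_nonneg (z.im - z'.im)]⟩
    obtain ⟨k1, k2⟩ := key (p i) (p j)
    obtain ⟨k3, k4⟩ := key (q i) (q j)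
    rw [k1, k3]
    have hij : 0 < v i * v j := mul_pos (hv i) (hv j)
    -- For y = 1.1 the minimum of 2x² - 2xy is -y²/2 = -0.605, at x = 11/20, so 4/5 is enough; 5/4
    -- in `c₅` is its reciprocal.
    have b1 : ∀ x y : ℝ, 0 < x → y ≤ 11 / 10 → 0 ≤ 4 / 5 + 2 * x ^ 2 - 2 * (x * y) := by
      intro x y hx hy
      nlinarith [sq_nonneg (x - 11 / 20), mul_nonneg hx.le (sub_nonneg.2 hy)]
    have b2 := mul_nonneg (b1 (v i) (v j) (hv i) (hv' j)) (sq_nonneg ‖q i‖)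
    have b3 := mul_nonneg (b1 (v j) (v i) (hv j) (hv' i)) (sq_nonneg ‖q j‖)
    have b4 := mul_le_mul_of_nonneg_left k2 hij.le
    have b5 := mul_le_mul_of_nonneg_left k4 hij.le
    linarith
  simp_rw [mul_add, sum_add_distrib] at e1 e2 e3
  simp_rw [edgeEnergy, sum_mul]
  have e4 : ∀ f : Fin n → Fin n → ℝ,
      ∑ i, ∑ j, w i j * (4 / 5 * f i j) = 4 / 5 * ∑ i, ∑ j, w i j * f i j := by
    intro f
    simp_rw [mul_sum]
    exact sum_congr rfl fun i _ => sum_congr rfl fun j _ => by ring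
  rw [e4, e4] at e3
  linarith

/-- The active power produced at bus `i` (times `σ`), for the angles `p` and the scaled voltages
`q` in the network `w`. -/
noncomputable def activeFlow (ρ : ℝ) (w : Fin n → Fin n → ℝ) (v : Fin n → ℝ) (σ : ℂ)
    (p q : Fin n → ℂ) (i : Fin n) : ℂ :=
  1 / (1 + (ρ + σ) ^ 2) *
      ∑ j, w i j * (v i * (v i * p i - v j * p j) + σ * (v i * (v i * q i - v j * q j))) -
    1 / (1 + ρ ^ 2) * ∑ j, w i j * (v i ^ 2 - v i * v j) * p i

/-- The reactive power produced at bus `i`. -/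
noncomputable def reactiveFlow (ρ : ℝ) (w : Fin n → Fin n → ℝ) (v : Fin n → ℝ) (σ : ℂ)
    (p q : Fin n → ℂ) (i : Fin n) : ℂ :=
  1 / (1 + (ρ + σ) ^ 2) *
      ∑ j, w i j * (v i * (v i * q i - v j * q j) - σ * (v i * (v i * p i - v j * p j))) +
    1 / (1 + ρ ^ 2) * ∑ j, w i j * (v i ^ 2 - v i * v j) * q i

/-- By summation by parts, the diagonal of the line matrix produces the energies, and its skew part
±σ the symplectic pairing, which enters with a factor i. -/
lemma sum_flow_eq (hs : ∀ i j, w i j = w j i) (σ : ℂ) (p q : Fin n → ℂ) :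
    ∑ i, (conj (p i) * activeFlow ρ w v σ p q i + conj (q i) * reactiveFlow ρ w v σ p q i) =
      1 / (1 + (ρ + σ) ^ 2) *
        ((edgeEnergy w (fun i => v i * p i) + edgeEnergy w (fun i => v i * q i) : ℝ) +
          σ * (edgePairing w (fun i => v i * p i) (fun i => v i * q i) * Complex.I)) +
      1 / (1 + ρ ^ 2) *
        (∑ i, ∑ j, w i j * ((v i ^ 2 - v i * v j) * (‖q i‖ ^ 2 - ‖p i‖ ^ 2)) : ℝ) := by
  push_cast
  rw [← sum_conj_mul_edge hs, ← sum_conj_mul_edge hs, ← sum_conj_mul_edge_sub hs]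
  simp only [activeFlow, reactiveFlow, mul_sum, mul_add, ← sum_add_distrib, ← sum_sub_distrib,
    mul_sub, ← Complex.conj_mul', map_mul, Complex.conj_ofReal]
  refine sum_congr rfl fun i _ => sum_congr rfl fun j _ => ?_
  ring

lemma network_form_lower_bound (hρ : 0 < ρ)
    (hc : ∀ u : ℝ, 2 * ρ * (1 + |u|) ≤ c * lineDenomSq ρ u)
    (hs : ∀ i j, w i j = w j i) (hw : ∀ i j, 0 ≤ w i j)
    (hv : ∀ i, 0 < v i) (hv' : ∀ i, v i ≤ vmax) (hvmax : vmax ≤ 11 / 10) {σ : ℂ} (hσ : 0 < σ.re)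
    (p q : Fin n → ℂ) :
    -(2 * c * vmax ^ 2 * ∑ i, (∑ j, w i j) * (‖p i‖ ^ 2 + ‖q i‖ ^ 2)) -
      (1 / σ).re * (1 / (1 + ρ ^ 2) * (4 / 5 * ∑ i, (∑ j, w i j) * ‖q i‖ ^ 2)) ≤
    (1 / σ * ∑ i, (conj (p i) * activeFlow ρ w v σ p q i +
      conj (q i) * reactiveFlow ρ w v σ p q i)).re := by
  rw [sum_flow_eq hs]
  have h1 := static_form_lower_bound hs hw hv (fun i => (hv' i).trans hvmax) p q
  have h2 := abs_edgePairing_le hw (fun i => v i * p i) (fun i => v i * q i)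
  have h3 : edgeEnergy w (fun i => v i * p i) + edgeEnergy w (fun i => v i * q i) ≤
      2 * vmax ^ 2 * ∑ i, (∑ j, w i j) * (‖p i‖ ^ 2 + ‖q i‖ ^ 2) := by
    refine (add_le_add (edgeEnergy_le hs hw _) (edgeEnergy_le hs hw _)).trans ?_
    rw [← mul_add, ← sum_add_distrib, mul_assoc, mul_sum (a := vmax ^ 2)]
    refine mul_le_mul_of_nonneg_left (sum_le_sum fun i _ => ?_) two_pos.le
    have hvi : v i ^ 2 ≤ vmax ^ 2 := pow_le_pow_left₀ (hv i).le (hv' i) 2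
    have hS : 0 ≤ ∑ j, w i j := sum_nonneg fun j _ => hw i j
    simp only [norm_mul, Complex.norm_real, mul_pow, Real.norm_eq_abs, sq_abs]
    have := mul_le_mul_of_nonneg_right hvi
      (mul_nonneg hS (add_nonneg (sq_nonneg ‖p i‖) (sq_nonneg ‖q i‖)))
    linarith
  set A := edgeEnergy w (fun i => v i * p i) + edgeEnergy w (fun i => v i * q i)
  set β := edgePairing w (fun i => v i * p i) (fun i => v i * q i)
  set E := ∑ i, ∑ j, w i j * ((v i ^ 2 - v i * v j) * (‖q i‖ ^ 2 - ‖p i‖ ^ 2))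
  have hσ0 : σ ≠ 0 := by rintro rfl; simp at hσ
  have hd := lineDenom_ne_zero hρ hσ.le
  have hρ1 : (1 : ℂ) + ρ ^ 2 ≠ 0 := by
    have : (1 : ℂ) + ρ ^ 2 = ((1 + ρ ^ 2 : ℝ) : ℂ) := by push_cast; rfl
    rw [this, Complex.ofReal_ne_zero]
    positivity
  -- The difference 1/(1+(ρ+σ)²) - 1/(1+ρ²) is divisible by σ, which leaves 1/σ only on the static
  -- form A + E. The rest is diagonalized by the components ε = ±1.
  have key : 1 / σ * (1 / (1 + (ρ + σ) ^ 2) * ((A : ℂ) + σ * (β * Complex.I)) +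
        1 / (1 + ρ ^ 2) * E) =
      (1 / (1 + ρ ^ 2) * (A + E) : ℝ) * (1 / σ) +
        (((A + β) / 2 : ℝ) * edgeTransfer ρ 1 σ + ((A - β) / 2 : ℝ) * edgeTransfer ρ (-1) σ) := by
    unfold edgeTransfer
    push_cast
    field_simp
    ring
  rw [key, Complex.add_re, Complex.add_re, Complex.re_ofReal_mul, Complex.re_ofReal_mul,
    Complex.re_ofReal_mul]
  have t1 := neg_le_edgeTransfer_re hρ (ε := 1) (by simp) hc hσ.le
  have t2 := neg_le_edgeTransfer_re hρ (ε := -1) (by simp) hc hσ.le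
  have hβ := abs_le.1 h2
  have u1 := mul_le_mul_of_nonneg_left t1 (show 0 ≤ (A + β) / 2 by linarith)
  have u2 := mul_le_mul_of_nonneg_left t2 (show 0 ≤ (A - β) / 2 by linarith)
  have hc0 : 0 ≤ c := by
    have h0 := hc 0
    have : 0 < c * lineDenomSq ρ 0 := lt_of_lt_of_le (by simp [hρ]) h0
    exact (pos_of_mul_pos_left this (lineDenomSq_pos hρ 0).le).le
  have hr : 0 ≤ (1 / σ).re := by
    rw [one_div, Complex.inv_re]
    exact div_nonneg hσ.le (Complex.normSq_nonneg _)
  have h4 := mul_le_mul_of_nonneg_left h1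
    (mul_nonneg hr (show 0 ≤ 1 / (1 + ρ ^ 2) by positivity))
  have h5 := mul_le_mul_of_nonneg_left h3 hc0
  linarith

end Coercivity

end GridForming

namespace GridForming

open Filter Topology Finset Polynomial

/-! ### Values of rational functions -/

/-- The rational function `f` is defined at `s`, with value `z`. -/
def HasValue (f : RatFunc ℝ) (s z : ℂ) : Prop :=
  ∃ p q : ℝ[X], f = algebraMap ℝ[X] (RatFunc ℝ) p / algebraMap ℝ[X] (RatFunc ℝ) q ∧
    aeval s q ≠ 0 ∧ z = aeval s p / aeval s q

lemma algebraMap_ne_zero_of_aeval {s : ℂ} {q : ℝ[X]} (hq : aeval s q ≠ 0) :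
    algebraMap ℝ[X] (RatFunc ℝ) q ≠ 0 :=
  RatFunc.algebraMap_ne_zero fun h => hq (by simp [h])

namespace HasValue

variable {f g : RatFunc ℝ} {s z z' : ℂ}

lemma congr_value (h : HasValue f s z) (e : z = z') : HasValue f s z' := e ▸ h

lemma C (a : ℝ) (s : ℂ) : HasValue (RatFunc.C a) s a :=
  ⟨Polynomial.C a, 1, by simp, by simp, by simp⟩

lemma X (s : ℂ) : HasValue RatFunc.X s s :=
  ⟨Polynomial.X, 1, by simp, by simp, by simp⟩

lemma zero (s : ℂ) : HasValue 0 s 0 := ⟨0, 1, by simp, by simp, by simp⟩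

lemma one (s : ℂ) : HasValue 1 s 1 := ⟨1, 1, by simp, by simp, by simp⟩

lemma add (hf : HasValue f s z) (hg : HasValue g s z') : HasValue (f + g) s (z + z') := by
  obtain ⟨p, q, rfl, hq, rfl⟩ := hf
  obtain ⟨p', q', rfl, hq', rfl⟩ := hg
  have h1 := algebraMap_ne_zero_of_aeval hq
  have h2 := algebraMap_ne_zero_of_aeval hq'
  refine ⟨p * q' + q * p', q * q', ?_, by simp [hq, hq'], ?_⟩
  · rw [div_add_div _ _ h1 h2]; simp
  · rw [div_add_div _ _ hq hq']; simp

lemma mul (hf : HasValue f s z) (hg : HasValue g s z') : HasValue (f * g) s (z * z') := by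
  obtain ⟨p, q, rfl, hq, rfl⟩ := hf
  obtain ⟨p', q', rfl, hq', rfl⟩ := hg
  exact ⟨p * p', q * q', by rw [div_mul_div_comm]; simp, by simp [hq, hq'],
    by rw [div_mul_div_comm]; simp⟩

lemma neg (hf : HasValue f s z) : HasValue (-f) s (-z) := by
  obtain ⟨p, q, rfl, hq, rfl⟩ := hf
  exact ⟨-p, q, by simp [neg_div], hq, by simp [neg_div]⟩

lemma inv (hf : HasValue f s z) (hz : z ≠ 0) : HasValue f⁻¹ s z⁻¹ := by
  obtain ⟨p, q, rfl, hq, rfl⟩ := hf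
  exact ⟨q, p, by rw [inv_div], fun h => hz (by simp [h]), by rw [inv_div]⟩

lemma div (hf : HasValue f s z) (hg : HasValue g s z') (hz : z' ≠ 0) :
    HasValue (f / g) s (z / z') := by
  simpa only [div_eq_mul_inv] using hf.mul (hg.inv hz)

lemma pow (hf : HasValue f s z) (k : ℕ) : HasValue (f ^ k) s (z ^ k) := by
  induction k with
  | zero => simpa using one s
  | succ k ih => simpa only [pow_succ] using ih.mul hf

lemma sum {ι : Type*} {t : Finset ι} {F : ι → RatFunc ℝ} {Z : ι → ℂ}
    (h : ∀ i ∈ t, HasValue (F i) s (Z i)) : HasValue (∑ i ∈ t, F i) s (∑ i ∈ t, Z i) := by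
  classical
  induction t using Finset.induction_on with
  | empty => simpa using zero s
  | insert a t ha ih =>
    rw [sum_insert ha, sum_insert ha]
    exact (h a (mem_insert_self a t)).add (ih fun i hi => h i (mem_insert_of_mem hi))

/-- Turns identities between rational functions into identities between their complex values. -/
lemma unique (h : HasValue f s z) (h' : HasValue f s z') : z = z' := by
  obtain ⟨p, q, rfl, hq, rfl⟩ := h
  obtain ⟨p', q', e, hq', rfl⟩ := h'
  rw [div_eq_div_iff (algebraMap_ne_zero_of_aeval hq) (algebraMap_ne_zero_of_aeval hq'),
    ← map_mul, ← map_mul] at e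
  have e' := congrArg (aeval s) (RatFunc.algebraMap_injective ℝ e)
  rw [map_mul, map_mul] at e'
  rw [div_eq_div_iff hq hq', e']

end HasValue

lemma hasValue_of_denom_ne_zero {f : RatFunc ℝ} {s : ℂ} (h : aeval s f.denom ≠ 0) :
    HasValue f s (aeval s f.num / aeval s f.denom) :=
  ⟨f.num, f.denom, (RatFunc.num_div_denom f).symm, h, rfl⟩

lemma eventually_denom_ne_zero (f : RatFunc ℝ) : ∀ᶠ s : ℂ in cofinite, aeval s f.denom ≠ 0 := by
  refine (f.denom.rootSet_finite ℂ).eventually_cofinite_notMem.mono fun s hs h => hs ?_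
  exact Polynomial.mem_rootSet.2 ⟨f.denom_ne_zero, h⟩

/-! ### Stable rational functions -/

namespace HasStablePoles

variable {f g : RatFunc ℝ}

lemma of_dvd (hf : HasStablePoles f) (hg : HasStablePoles g) {h : RatFunc ℝ}
    (hd : h.denom ∣ f.denom * g.denom) : HasStablePoles h := by
  intro s hs
  have : aeval s (f.denom * g.denom) = 0 := aeval_eq_zero_of_dvd_aeval_eq_zero hd hs
  rw [map_mul, mul_eq_zero] at this
  exact this.elim (hf s) (hg s)

lemma add (hf : HasStablePoles f) (hg : HasStablePoles g) : HasStablePoles (f + g) :=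
  hf.of_dvd hg (RatFunc.denom_add_dvd f g)

lemma mul (hf : HasStablePoles f) (hg : HasStablePoles g) : HasStablePoles (f * g) :=
  hf.of_dvd hg (RatFunc.denom_mul_dvd f g)

lemma polynomial (p : ℝ[X]) : HasStablePoles (algebraMap ℝ[X] (RatFunc ℝ) p) := by
  intro s hs
  simp at hs

lemma C (a : ℝ) : HasStablePoles (RatFunc.C a) := by
  simpa using polynomial (Polynomial.C a)

lemma zero : HasStablePoles 0 := by simpa using C 0

lemma one : HasStablePoles 1 := by simpa using C 1

lemma neg (hf : HasStablePoles f) : HasStablePoles (-f) := by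
  have : -f = RatFunc.C (-1) * f := by simp
  rw [this]
  exact (C _).mul hf

end HasStablePoles

/-- Along a horizontal ray that starts at a pole, a rational function grows at least like the
inverse of the distance. -/
lemma denom_ne_zero_of_bound {f : RatFunc ℝ} {s₀ : ℂ} {K : ℝ}
    (h : ∀ᶠ t : ℝ in 𝓝[>] 0,
      ‖aeval (s₀ + t) f.num / aeval (s₀ + t) f.denom‖ * √t ≤ K) :
    aeval s₀ f.denom ≠ 0 := by
  intro h0
  obtain ⟨r, hr⟩ : (Polynomial.X - Polynomial.C s₀) ∣ f.denom.map (algebraMap ℝ ℂ) := by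
    rw [dvd_iff_isRoot, IsRoot, eval_map_algebraMap, h0]
  have hden : ∀ t : ℝ, aeval (s₀ + t) f.denom = t * r.eval (s₀ + t) := by
    intro t
    rw [← eval_map_algebraMap, hr]
    simp
  have hcont (P : ℂ[X]) : Tendsto (fun t : ℝ => P.eval (s₀ + t)) (𝓝[>] 0) (𝓝 (P.eval s₀)) := by
    have : Continuous fun t : ℝ => P.eval (s₀ + t) := by fun_prop
    exact (this.tendsto' 0 _ (by simp)).mono_left nhdsWithin_le_nhds
  have hnum : Tendsto (fun t : ℝ => aeval (s₀ + t) f.num) (𝓝[>] 0) (𝓝 (aeval s₀ f.num)) := by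
    simpa only [eval_map_algebraMap] using hcont (f.num.map (algebraMap ℝ ℂ))
  have hray : Tendsto (fun t : ℝ => s₀ + t) (𝓝[>] 0) (𝓝[≠] s₀) := by
    refine tendsto_nhdsWithin_iff.2 ⟨?_, ?_⟩
    · have : Continuous fun t : ℝ => s₀ + t := by fun_prop
      exact (this.tendsto' 0 _ (by simp)).mono_left nhdsWithin_le_nhds
    · filter_upwards [self_mem_nhdsWithin] with t ht
      simpa using (ne_of_gt ht : t ≠ 0)
  have hne : ∀ᶠ t : ℝ in 𝓝[>] 0, aeval (s₀ + t) f.denom ≠ 0 :=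
    hray.eventually ((nhdsNE_le_cofinite s₀) (eventually_denom_ne_zero f))
  have hzero : Tendsto (fun t : ℝ => aeval (s₀ + t) f.num) (𝓝[>] 0) (𝓝 0) := by
    have hs : Tendsto (fun t : ℝ => K * √t * ‖r.eval (s₀ + t)‖) (𝓝[>] 0) (𝓝 0) := by
      have h1 : Tendsto (fun t : ℝ => √t) (𝓝[>] 0) (𝓝 0) :=
        (Real.continuous_sqrt.tendsto' 0 0 (by simp)).mono_left nhdsWithin_le_nhds
      simpa using (h1.const_mul K).mul (hcont r).norm
    refine squeeze_zero_norm' ?_ hs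
    filter_upwards [h, hne, self_mem_nhdsWithin] with t h1 h2 ht
    have ht : 0 < t := ht
    -- Since the denominator is t·r(s₀ + t), one factor √t goes to the bounded quantity and the
    -- other forces the numerator to vanish at s₀, against coprimality.
    have h3 : ‖aeval (s₀ + t) f.num‖ =
        ‖aeval (s₀ + t) f.num / aeval (s₀ + t) f.denom‖ * √t * (√t * ‖r.eval (s₀ + t)‖) := by
      have e : ‖aeval (s₀ + (t : ℂ)) f.denom‖ = √t * √t * ‖r.eval (s₀ + t)‖ := by
        rw [hden, norm_mul, Real.mul_self_sqrt ht.le]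
        simp [abs_of_pos ht]
      have e2 : ‖aeval (s₀ + (t : ℂ)) f.denom‖ ≠ 0 := norm_ne_zero_iff.2 h2
      rw [norm_div]
      have : ∀ a b x y : ℝ, b ≠ 0 → b = x * x * y → a = a / b * x * (x * y) := by
        intro a b x y hb h
        rw [show a / b * x * (x * y) = a / b * (x * x * y) by ring, ← h, div_mul_cancel₀ _ hb]
      exact this _ _ _ _ e2 e
    rw [h3, mul_assoc K]
    exact mul_le_mul_of_nonneg_right h1 (by positivity)
  have h1 := tendsto_nhds_unique hnum hzero
  obtain ⟨a, b, hab⟩ := RatFunc.isCoprime_num_denom f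
  have := congrArg (aeval s₀) hab
  simp [h0, h1] at this

/-! ### Proper rational functions -/

/-- A rational function vanishes at infinity. -/
def IsStrictlyProper (f : RatFunc ℝ) : Prop := f = 0 ∨ f.intDegree < 0

lemma isProper_iff {f : RatFunc ℝ} : IsProper f ↔ f.intDegree ≤ 0 := by
  rw [IsProper, RatFunc.intDegree]
  omega

lemma IsStrictlyProper.isProper {f : RatFunc ℝ} (h : IsStrictlyProper f) : IsProper f := by
  rw [isProper_iff]
  rcases h with rfl | h
  · simp
  · exact h.le

namespace IsProper

variable {f g : RatFunc ℝ}

lemma C (a : ℝ) : IsProper (RatFunc.C a) := by simp [isProper_iff]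

lemma zero : IsProper 0 := by simpa using C 0

lemma one : IsProper 1 := by simpa using C 1

lemma mul (hf : IsProper f) (hg : IsProper g) : IsProper (f * g) := by
  rw [isProper_iff] at *
  rcases eq_or_ne f 0 with rfl | h
  · simp
  rcases eq_or_ne g 0 with rfl | h'
  · simp
  rw [RatFunc.intDegree_mul h h']
  omega

lemma add (hf : IsProper f) (hg : IsProper g) : IsProper (f + g) := by
  rw [isProper_iff] at *
  rcases eq_or_ne g 0 with rfl | h'
  · simpa
  rcases eq_or_ne (f + g) 0 with h | h
  · simp [h]
  exact (RatFunc.intDegree_add_le h' h).trans (max_le hf hg)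

lemma neg (hf : IsProper f) : IsProper (-f) := by
  rwa [isProper_iff, RatFunc.intDegree_neg, ← isProper_iff]

lemma sum {ι : Type*} {t : Finset ι} {F : ι → RatFunc ℝ}
    (h : ∀ i ∈ t, IsProper (F i)) : IsProper (∑ i ∈ t, F i) :=
  Finset.sum_induction _ _ (fun _ _ => add) zero h

end IsProper

namespace IsStrictlyProper

variable {f g : RatFunc ℝ}

lemma zero : IsStrictlyProper 0 := Or.inl rfl

lemma mul_isProper (hf : IsStrictlyProper f) (hg : IsProper g) : IsStrictlyProper (f * g) := by
  rcases eq_or_ne f 0 with rfl | h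
  · simp [zero]
  rcases eq_or_ne g 0 with rfl | h'
  · simp [zero]
  rw [isProper_iff] at hg
  have := hf.resolve_left h
  right
  rw [RatFunc.intDegree_mul h h']
  omega

lemma add (hf : IsStrictlyProper f) (hg : IsStrictlyProper g) : IsStrictlyProper (f + g) := by
  rcases eq_or_ne f 0 with rfl | h
  · simpa
  rcases eq_or_ne g 0 with rfl | h'
  · simpa
  rcases eq_or_ne (f + g) 0 with h0 | h0
  · exact Or.inl h0
  exact Or.inr ((RatFunc.intDegree_add_le h' h0).trans_lt
    (max_lt (hf.resolve_left h) (hg.resolve_left h')))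

lemma neg (hf : IsStrictlyProper f) : IsStrictlyProper (-f) := by
  rwa [IsStrictlyProper, RatFunc.intDegree_neg, neg_eq_zero]

lemma sum {ι : Type*} {t : Finset ι} {F : ι → RatFunc ℝ}
    (h : ∀ i ∈ t, IsStrictlyProper (F i)) : IsStrictlyProper (∑ i ∈ t, F i) :=
  Finset.sum_induction _ _ (fun _ _ => add) zero h

end IsStrictlyProper

/-- A vector of rational functions is proper if it solves `x = y - E x` with `E` strictly proper and
`y` proper. -/
lemma isProper_of_fixed_point {ι : Type*} [Fintype ι] {E : Matrix ι ι (RatFunc ℝ)}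
    (hE : ∀ i j, IsStrictlyProper (E i j)) {x y : ι → RatFunc ℝ} (hy : ∀ i, IsProper (y i))
    (h : ∀ i, x i = y i - ∑ j, E i j * x j) (i : ι) : IsProper (x i) := by
  by_contra hi
  obtain ⟨m, -, hm⟩ := Finset.exists_max_image univ (fun j => (x j).intDegree) ⟨i, mem_univ i⟩
  have hpos : 0 < (x m).intDegree := by
    rw [isProper_iff, not_le] at hi
    exact hi.trans_le (hm i (mem_univ i))
  have hxm : x m ≠ 0 := by rintro h; simp [h] at hpos
  -- Dividing by an entry of maximal, positive degree makes every entry proper and 1/x_m strictly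
  -- proper; row m then presents 1 as strictly proper.
  have key : ∀ j, IsProper ((x m)⁻¹ * x j) := by
    intro j
    rcases eq_or_ne (x j) 0 with h | h
    · simp [h, IsProper.zero]
    · rw [isProper_iff, RatFunc.intDegree_mul (inv_ne_zero hxm) h, RatFunc.intDegree_inv]
      have := hm j (mem_univ j)
      omega
  have hinv : IsStrictlyProper (x m)⁻¹ := by
    right
    rw [RatFunc.intDegree_inv]
    omega
  have h1 : (1 : RatFunc ℝ) = (x m)⁻¹ * y m + -∑ j, E m j * ((x m)⁻¹ * x j) := by
    have e : ∑ j, E m j * ((x m)⁻¹ * x j) = (x m)⁻¹ * ∑ j, E m j * x j := by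
      rw [mul_sum]
      exact sum_congr rfl fun j _ => by ring
    rw [e, ← sub_eq_add_neg, ← mul_sub, ← h m, inv_mul_cancel₀ hxm]
  have h2 : IsStrictlyProper (1 : RatFunc ℝ) := by
    rw [h1]
    exact (hinv.mul_isProper (hy m)).add
      (IsStrictlyProper.sum fun j _ => (hE m j).mul_isProper (key j)).neg
  rcases h2 with h2 | h2
  · exact one_ne_zero h2
  · simp at h2

lemma eq_zero_of_fixed_point {ι : Type*} [Fintype ι] {E : Matrix ι ι (RatFunc ℝ)}
    (hE : ∀ i j, IsStrictlyProper (E i j)) {x : ι → RatFunc ℝ}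
    (h : ∀ i, x i = -∑ j, E i j * x j) : x = 0 := by
  by_contra hx
  obtain ⟨k, hk⟩ := Function.ne_iff.1 hx
  have hk : x k ≠ 0 := hk
  -- The homogeneous equation may be rescaled so that entry k becomes `RatFunc.X`, which is not
  -- proper.
  have := isProper_of_fixed_point hE (x := fun i => RatFunc.X * (x k)⁻¹ * x i) (y := 0)
    (fun _ => IsProper.zero) (fun i => by
      conv_lhs => rw [h i]
      rw [Pi.zero_apply, zero_sub, mul_neg, mul_sum]
      congr 1
      exact sum_congr rfl fun j _ => by ring) k
  rw [mul_assoc, inv_mul_cancel₀ hk, mul_one, isProper_iff] at this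
  simp at this

end GridForming

namespace GridForming

open Filter Topology Finset

/-! ### The coercivity estimate for the closed loop -/

section Bound

open ComplexConjugate

variable {n : ℕ}

/-- The line susceptances, without the irrelevant diagonal. -/
noncomputable def lineWeight (b : Fin n → Fin n → ℝ) (i j : Fin n) : ℝ :=
  if i = j then 0 else b i j

lemma sum_lineWeight (b : Fin n → Fin n → ℝ) (i : Fin n) :
    ∑ j, lineWeight b i j = selfSusceptance b i := by
  rw [selfSusceptance, ← add_sum_erase univ _ (mem_univ i)]
  rw [lineWeight, if_pos rfl, zero_add]
  exact sum_congr rfl fun j hj => if_neg (ne_of_mem_erase hj).symm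

lemma sum_lineWeight_mul (b : Fin n → Fin n → ℝ) (i : Fin n) (f : Fin n → ℂ) :
    ∑ j, (lineWeight b i j : ℂ) * f j = ∑ j ∈ univ.erase i, (b i j : ℂ) * f j := by
  rw [← add_sum_erase univ _ (mem_univ i)]
  rw [lineWeight, if_pos rfl, Complex.ofReal_zero, zero_mul, zero_add]
  exact sum_congr rfl fun j hj => by rw [lineWeight, if_neg (ne_of_mem_erase hj).symm]

lemma exists_pos_forall_le {ι : Type*} [Finite ι] {f : ι → ℝ} (hf : ∀ i, 0 < f i) :
    ∃ ε > 0, ∀ i, ε ≤ f i := by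
  cases isEmpty_or_nonempty ι
  · exact ⟨1, one_pos, fun i => isEmptyElim i⟩
  · obtain ⟨i, hi⟩ := Finite.exists_min f
    exact ⟨f i, hf i, hi⟩

variable {ω₀ ρ vmax : ℝ} {b : Fin n → Fin n → ℝ} {v dp dq τp τq : Fin n → ℝ}

/-- Under the decentralized conditions, the interconnection dominates the edges of the network. -/
lemma exists_margins (hω₀ : 0 < ω₀) (hρ : 0 < ρ) (hb_nonneg : ∀ i j, 0 ≤ b i j)
    (hv_pos : ∀ i, 0 < v i) (hv_le : ∀ i, v i ≤ vmax)
    (hdp : ∀ i, 0 < dp i) (hdq : ∀ i, 0 < dq i)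
    (hp : ∀ i, ActivePowerConditions ρ
      (dp i / ω₀ * vmax ^ 2 * selfSusceptance b i) (τp i * ω₀))
    (hq : ∀ i, ReactivePowerConditions ρ vmax
      (dq i / v i * selfSusceptance b i) (τq i * ω₀)) :
    ∃ c : ℝ, (∀ u : ℝ, 2 * ρ * (1 + |u|) ≤ c * lineDenomSq ρ u) ∧ ∃ ε > 0, ∀ i,
      ε ≤ ω₀ / dp i - 2 * c * vmax ^ 2 * selfSusceptance b i ∧
      ε ≤ v i / dq i * (τq i * ω₀) - 2 * c * vmax ^ 2 * selfSusceptance b i ∧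
      ε ≤ v i / dq i - 1 / (1 + ρ ^ 2) * (4 / 5 * selfSusceptance b i) := by
  obtain ⟨u, hu⟩ := exists_edge_bound hρ
  refine ⟨_, hu, ?_⟩
  have hS : ∀ i, 0 ≤ selfSusceptance b i := fun i => sum_nonneg fun j _ => hb_nonneg i j
  have hΔ := lineDenomSq_pos hρ u
  -- Because the worst frequency u is attained, the strict inequality of the droop conditions at u
  -- alone gives a strict inequality with c.
  set c := 2 * ρ * (1 + |u|) / lineDenomSq ρ u with hc
  have hcΔ : c * lineDenomSq ρ u = 2 * ρ * (1 + |u|) := div_mul_cancel₀ _ hΔ.ne'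
  have hvm : ∀ i : Fin n, 0 < vmax := fun i => (hv_pos i).trans_le (hv_le i)
  have h1 : ∀ i, 0 < ω₀ / dp i - 2 * c * vmax ^ 2 * selfSusceptance b i := by
    intro i
    have h := (hp i).lt_lineDenomSq hρ
      (mul_nonneg (mul_nonneg (div_pos (hdp i) hω₀).le (sq_nonneg _)) (hS i)) u
    set S := selfSusceptance b i
    have h2 : 2 * c * (dp i / ω₀ * vmax ^ 2 * S) < 1 := by
      refine lt_of_mul_lt_mul_right ?_ hΔ.le
      linear_combination h + 2 * (dp i / ω₀ * vmax ^ 2 * S) * hcΔ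
    rw [sub_pos, lt_div_iff₀ (hdp i)]
    have h3 := mul_lt_mul_of_pos_right h2 hω₀
    have e : 2 * c * (dp i / ω₀ * vmax ^ 2 * S) * ω₀ = 2 * c * vmax ^ 2 * S * dp i := by
      field_simp
    linarith
  have h2 : ∀ i, 0 < v i / dq i * (τq i * ω₀) - 2 * c * vmax ^ 2 * selfSusceptance b i := by
    intro i
    have h := (hq i).lt_lineDenomSq hρ (hvm i)
      (mul_nonneg (div_pos (hdq i) (hv_pos i)).le (hS i)) u
    set S := selfSusceptance b i
    have h2 : 2 * c * (dq i / v i * S * vmax ^ 2) < τq i * ω₀ := by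
      refine lt_of_mul_lt_mul_right ?_ hΔ.le
      linear_combination h + 2 * (dq i / v i * S * vmax ^ 2) * hcΔ
    have h3 := mul_lt_mul_of_pos_left h2 (div_pos (hv_pos i) (hdq i))
    have e : v i / dq i * (2 * c * (dq i / v i * S * vmax ^ 2)) = 2 * c * vmax ^ 2 * S := by
      have := (hv_pos i).ne'
      have := (hdq i).ne'
      field_simp
    linarith
  have h3 : ∀ i, 0 < v i / dq i - 1 / (1 + ρ ^ 2) * (4 / 5 * selfSusceptance b i) := by
    intro i
    have h := (hq i).cond₁
    rw [c₅] at h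
    set S := selfSusceptance b i
    have h3 := mul_lt_mul_of_pos_left h (div_pos (hv_pos i) (hdq i))
    have e : v i / dq i * (dq i / v i * S) = S := by
      have := (hv_pos i).ne'
      have := (hdq i).ne'
      field_simp
    rw [e] at h3
    have hρ1 : 0 < 1 + ρ ^ 2 := by positivity
    rw [sub_pos, one_div_mul_eq_div, div_lt_iff₀ hρ1]
    linarith
  obtain ⟨ε, hε, hm⟩ := exists_pos_forall_le fun i => lt_min (h1 i) (lt_min (h2 i) (h3 i))
  exact ⟨ε, hε, fun i => by simpa only [le_min_iff] using hm i⟩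

/-- A uniform bound in the open right half plane for the response of the interconnection to a unit
disturbance. -/
lemma exists_response_bound (hω₀ : 0 < ω₀) (hρ : 0 < ρ)
    (hb_symm : ∀ i j, b i j = b j i) (hb_nonneg : ∀ i j, 0 ≤ b i j)
    (hv_pos : ∀ i, 0 < v i) (hv_le : ∀ i, v i ≤ vmax) (hvmax : vmax ≤ 11 / 10)
    (hdp : ∀ i, 0 < dp i) (hdq : ∀ i, 0 < dq i) (hτp : ∀ i, 0 ≤ τp i)
    (hp : ∀ i, ActivePowerConditions ρ
      (dp i / ω₀ * vmax ^ 2 * selfSusceptance b i) (τp i * ω₀))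
    (hq : ∀ i, ReactivePowerConditions ρ vmax
      (dq i / v i * selfSusceptance b i) (τq i * ω₀)) :
    ∃ K : ℝ, ∀ (s : ℂ) (t : ℝ), 0 < t → t ≤ 1 → t ≤ s.re →
      ∀ (y f : Fin n × Fin 2 → ℂ) (k : Fin n × Fin 2), (∀ x, f x = if x = k then 1 else 0) →
      (∀ i, (τp i * s + 1) / dp i * y (i, 0) + 1 / s * activeFlow ρ (lineWeight b) v (s / ω₀)
        (fun i => y (i, 0)) (fun i => s / v i * y (i, 1)) i = f (i, 0)) →
      (∀ i, (τq i * s + 1) / dq i * y (i, 1) + 1 / s * reactiveFlow ρ (lineWeight b) v (s / ω₀)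
        (fun i => y (i, 0)) (fun i => s / v i * y (i, 1)) i = f (i, 1)) →
      ∀ x, ‖y x‖ * √t ≤ K := by
  obtain ⟨c, hc, ε, hε, hm⟩ := exists_margins hω₀ hρ hb_nonneg hv_pos hv_le hdp hdq hp hq
  refine ⟨√((ω₀ / ε) ^ 2 + vmax ^ 2 * ω₀ / ε ^ 2), ?_⟩
  intro s t ht ht1 hts y f k hf hP hQ x
  have hs : 0 < s.re := ht.trans_le hts
  have hs0 : s ≠ 0 := by rintro rfl; simp at hs
  have hω : (ω₀ : ℂ) ≠ 0 := Complex.ofReal_ne_zero.2 hω₀.ne'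
  set σ : ℂ := s / ω₀ with hσ_def
  have hσ : 0 < σ.re := by
    rw [hσ_def, Complex.div_ofReal_re]
    exact div_pos hs hω₀
  set p : Fin n → ℂ := fun i => y (i, 0) with hp_def
  -- This scaling puts the same factor 1/s on both columns of the network, and turns the reactive
  -- device term into (v/d_q)(τ̃_q + 1/σ)|q|².
  set q : Fin n → ℂ := fun i => s / v i * y (i, 1) with hq_def
  have hform := network_form_lower_bound (w := lineWeight b) hρ hc
    (fun i j => by simp only [lineWeight, hb_symm i j, eq_comm])
    (fun i j => by unfold lineWeight; split_ifs <;> simp [hb_nonneg]) hv_pos hv_le hvmax hσ p q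
  simp_rw [sum_lineWeight] at hform
  have hbal : ∑ i, (((ω₀ / dp i * ‖p i‖ ^ 2 : ℝ) : ℂ) + ((ω₀ / dp i * (τp i * ω₀) *
        ‖p i‖ ^ 2 : ℝ) : ℂ) * σ + (((v i / dq i * (τq i * ω₀) * ‖q i‖ ^ 2 : ℝ) : ℂ) +
        ((v i / dq i * ‖q i‖ ^ 2 : ℝ) : ℂ) * (1 / σ))) +
      1 / σ * ∑ i, (conj (p i) * activeFlow ρ (lineWeight b) v σ p q i +
        conj (q i) * reactiveFlow ρ (lineWeight b) v σ p q i) =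
      ω₀ * ∑ i, (conj (p i) * f (i, 0) + conj (q i) * f (i, 1)) := by
    rw [mul_sum, mul_sum, ← sum_add_distrib]
    refine sum_congr rfl fun i _ => ?_
    rw [← hP i, ← hQ i]
    push_cast
    rw [← Complex.conj_mul', ← Complex.conj_mul']
    have hvi : (v i : ℂ) ≠ 0 := Complex.ofReal_ne_zero.2 (hv_pos i).ne'
    have hdpi : (dp i : ℂ) ≠ 0 := Complex.ofReal_ne_zero.2 (hdp i).ne'
    have hdqi : (dq i : ℂ) ≠ 0 := Complex.ofReal_ne_zero.2 (hdq i).ne'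
    have e : y (i, 1) = v i / s * q i := by rw [hq_def]; field_simp
    rw [e, hσ_def]
    change _ = (ω₀ : ℂ) * (conj (p i) * ((τp i * s + 1) / dp i * p i + _) + _)
    field_simp
    ring
  set ξ : Fin n × Fin 2 → ℂ := fun x => if x.2 = 0 then p x.1 else q x.1 with hξ
  have hrhs : ∑ i, (conj (p i) * f (i, 0) + conj (q i) * f (i, 1)) = conj (ξ k) := by
    have : ∑ x : Fin n × Fin 2, conj (ξ x) * f x = conj (ξ k) := by
      simp only [hf, mul_ite, mul_one, mul_zero, sum_ite_eq', mem_univ, if_true]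
    rw [← this, Fintype.sum_prod_type]
    exact sum_congr rfl fun i _ => by simp [hξ]
  rw [hrhs] at hbal
  have hre := congrArg Complex.re hbal
  rw [Complex.add_re, Complex.re_sum, Complex.re_ofReal_mul, Complex.conj_re] at hre
  simp only [Complex.add_re, Complex.re_ofReal_mul, Complex.ofReal_re] at hre
  set r := (1 / σ).re with hr_def
  have hr_eq : r = ω₀ * s.re / ‖s‖ ^ 2 := by
    rw [hr_def, hσ_def, one_div_div, Complex.div_re, Complex.normSq_eq_norm_sq]
    simp
  have hr : 0 < r := by
    rw [hr_eq]
    have := norm_pos_iff.2 hs0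
    positivity
  have hcoer : ε * ∑ i, (‖p i‖ ^ 2 + ‖q i‖ ^ 2 + r * ‖q i‖ ^ 2) ≤ ω₀ * ‖ξ k‖ := by
    have h1 : ω₀ * (ξ k).re ≤ ω₀ * ‖ξ k‖ :=
      mul_le_mul_of_nonneg_left (Complex.re_le_norm _) hω₀.le
    refine le_trans ?_ h1
    rw [← hre]
    refine le_trans ?_ (add_le_add_right hform _)
    simp only [mul_sum, ← sum_neg_distrib, ← sum_sub_distrib, ← sum_add_distrib]
    refine sum_le_sum fun i _ => ?_
    obtain ⟨m1, m2, m3⟩ := hm i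
    have a1 := mul_le_mul_of_nonneg_right m1 (sq_nonneg ‖p i‖)
    have a2 := mul_le_mul_of_nonneg_right m2 (sq_nonneg ‖q i‖)
    have a3 := mul_le_mul_of_nonneg_right m3 (mul_nonneg hr.le (sq_nonneg ‖q i‖))
    have a4 : 0 ≤ ω₀ / dp i * (τp i * ω₀) * ‖p i‖ ^ 2 * σ.re := by
      have := hτp i
      have := hdp i
      positivity
    linarith
  have hterm : ∀ i, ‖p i‖ ^ 2 + ‖q i‖ ^ 2 + r * ‖q i‖ ^ 2 ≤
      ∑ i, (‖p i‖ ^ 2 + ‖q i‖ ^ 2 + r * ‖q i‖ ^ 2) := fun i =>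
    single_le_sum (f := fun i => ‖p i‖ ^ 2 + ‖q i‖ ^ 2 + r * ‖q i‖ ^ 2)
      (fun i _ => by positivity) (mem_univ i)
  have hk : ‖ξ k‖ ^ 2 ≤ ‖p k.1‖ ^ 2 + ‖q k.1‖ ^ 2 + r * ‖q k.1‖ ^ 2 := by
    have h1 : 0 ≤ r * ‖q k.1‖ ^ 2 := by positivity
    simp only [hξ]
    split_ifs <;> nlinarith [sq_nonneg ‖p k.1‖, sq_nonneg ‖q k.1‖]
  -- The disturbance is a unit vector, so the right side of `hcoer` is linear in one entry of (p, q)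
  -- while the left side dominates its square.
  have hξk : ε * ‖ξ k‖ ≤ ω₀ := by
    rcases (norm_nonneg (ξ k)).eq_or_lt with h | h
    · rw [← h]; linarith
    · refine le_of_mul_le_mul_right ?_ h
      have := mul_le_mul_of_nonneg_left (hk.trans (hterm k.1)) hε.le
      linarith
  have hall : ∀ i, ‖p i‖ ^ 2 + ‖q i‖ ^ 2 + r * ‖q i‖ ^ 2 ≤ (ω₀ / ε) ^ 2 := by
    intro i
    rw [div_pow, le_div_iff₀ (by positivity)]
    have h1 := mul_le_mul_of_nonneg_left (hterm i) hε.le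
    have h2 := mul_le_mul_of_nonneg_left (h1.trans hcoer) hε.le
    have h3 := mul_le_mul_of_nonneg_left hξk hω₀.le
    linarith
  refine Real.le_sqrt_of_sq_le ?_
  rw [mul_pow, Real.sq_sqrt ht.le]
  obtain ⟨i, a⟩ := x
  have hi := hall i
  have hvm : 0 ≤ vmax ^ 2 * ω₀ / ε ^ 2 := by positivity
  have hr' : 0 ≤ r * ‖q i‖ ^ 2 := by positivity
  fin_cases a
  · have h1 : ‖p i‖ ^ 2 * t ≤ ‖p i‖ ^ 2 := mul_le_of_le_one_right (sq_nonneg _) ht1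
    change ‖p i‖ ^ 2 * t ≤ _
    linarith [sq_nonneg ‖q i‖]
  · change ‖y (i, 1)‖ ^ 2 * t ≤ _
    have hvi := hv_pos i
    -- The bound on |q| degenerates for y_(i,1) as s → 0. The term with r = ω₀ Re s/|s|² cancels the
    -- |s|² in |q|² and bounds |y|² Re s uniformly; this is where √t comes from.
    have e : r * ‖q i‖ ^ 2 * v i ^ 2 = ω₀ * (‖y (i, 1)‖ ^ 2 * s.re) := by
      have : ‖s‖ ≠ 0 := norm_ne_zero_iff.2 hs0
      rw [hr_eq, hq_def]
      simp only [norm_mul, norm_div, Complex.norm_real, Real.norm_of_nonneg hvi.le]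
      field_simp
    have h2 : r * ‖q i‖ ^ 2 ≤ (ω₀ / ε) ^ 2 := by
      linarith [sq_nonneg ‖q i‖, sq_nonneg ‖p i‖]
    have h3 : v i ^ 2 ≤ vmax ^ 2 := pow_le_pow_left₀ hvi.le (hv_le i) 2
    have h4 := mul_le_mul h2 h3 (sq_nonneg _) (sq_nonneg _)
    rw [e] at h4
    have h5 : ‖y (i, 1)‖ ^ 2 * t ≤ ‖y (i, 1)‖ ^ 2 * s.re :=
      mul_le_mul_of_nonneg_left hts (sq_nonneg _)
    have h6 : ‖y (i, 1)‖ ^ 2 * s.re ≤ vmax ^ 2 * ω₀ / ε ^ 2 := by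
      refine le_of_mul_le_mul_left (h4.trans_eq ?_) hω₀
      field_simp
    linarith [sq_nonneg (ω₀ / ε)]

end Bound

end GridForming

namespace GridForming

open Filter Topology Finset

/-! ### The device dynamics -/

section Device

variable {n : ℕ} {dp dq τp τq : Fin n → ℝ}

/-- The inverse of a first-order lag. -/
noncomputable def lagInverse (d τ : ℝ) : Polynomial ℝ :=
  Polynomial.C (1 / d) * (Polynomial.C τ * Polynomial.X + 1)

/-- The inverse of the device dynamics. -/
noncomputable def deviceInverse (dp dq τp τq : Fin n → ℝ) (x : Fin n × Fin 2) : RatFunc ℝ :=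
  algebraMap _ _ (![lagInverse (dp x.1) (τp x.1), lagInverse (dq x.1) (τq x.1)] x.2)

lemma lag_ne_zero (τ : ℝ) : RatFunc.C τ * RatFunc.X + 1 ≠ (0 : RatFunc ℝ) := by
  have : (RatFunc.C τ * RatFunc.X + 1 : RatFunc ℝ) =
      algebraMap _ _ (Polynomial.C τ * Polynomial.X + 1) := by simp
  rw [this]
  refine RatFunc.algebraMap_ne_zero fun h => ?_
  simpa using congrArg (Polynomial.eval 0) h

lemma lag_eq_inv (d τ : ℝ) :
    RatFunc.C d / (RatFunc.C τ * RatFunc.X + 1) =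
      (algebraMap (Polynomial ℝ) (RatFunc ℝ) (lagInverse d τ))⁻¹ := by
  rw [lagInverse, map_mul, RatFunc.algebraMap_C, mul_inv, ← map_inv₀, one_div, inv_inv,
    div_eq_mul_inv]
  simp

lemma deviceDynamics_eq :
    deviceDynamics dp dq τp τq =
      Matrix.diagonal fun x => (deviceInverse dp dq τp τq x)⁻¹ := by
  ext ⟨i, a⟩ ⟨j, c⟩
  rw [deviceDynamics, Matrix.comp_apply]
  by_cases hij : i = j
  · subst hij
    rw [Matrix.diagonal_apply_eq, converterBlock, lag_eq_inv, lag_eq_inv]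
    fin_cases a <;> fin_cases c <;> simp [deviceInverse]
  · rw [Matrix.diagonal_apply_ne _ hij, Matrix.diagonal_apply_ne _ (by simp [hij]),
      Matrix.zero_apply]

lemma deviceInverse_ne_zero (hdp : ∀ i, 0 < dp i) (hdq : ∀ i, 0 < dq i) (x : Fin n × Fin 2) :
    deviceInverse dp dq τp τq x ≠ 0 := by
  obtain ⟨i, a⟩ := x
  have h : ∀ d τ : ℝ, 0 < d → algebraMap (Polynomial ℝ) (RatFunc ℝ) (lagInverse d τ) ≠ 0 := by
    intro d τ hd
    refine inv_eq_zero.not.1 ?_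
    rw [← lag_eq_inv]
    exact div_ne_zero (by simpa using hd.ne') (lag_ne_zero τ)
  fin_cases a
  · exact h _ _ (hdp i)
  · exact h _ _ (hdq i)

lemma hasValue_lagInverse (d τ : ℝ) (s : ℂ) :
    HasValue (algebraMap (Polynomial ℝ) (RatFunc ℝ) (lagInverse d τ)) s ((τ * s + 1) / d) := by
  have := (HasValue.C (1 / d) s).mul (((HasValue.C τ s).mul (HasValue.X s)).add (HasValue.one s))
  simp only [lagInverse, map_mul, map_add, map_one, RatFunc.algebraMap_C, RatFunc.algebraMap_X]
  refine this.congr_value ?_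
  push_cast
  ring

lemma isProper_lag (d τ : ℝ) : IsProper (RatFunc.C d / (RatFunc.C τ * RatFunc.X + 1)) := by
  rw [div_eq_mul_inv]
  refine (IsProper.C d).mul ?_
  have : (RatFunc.C τ * RatFunc.X + 1 : RatFunc ℝ) =
      algebraMap _ _ (Polynomial.C τ * Polynomial.X + 1) := by simp
  rw [isProper_iff, RatFunc.intDegree_inv, this, RatFunc.intDegree_polynomial]
  omega

lemma isStrictlyProper_lag (d : ℝ) {τ : ℝ} (hτ : τ ≠ 0) :
    IsStrictlyProper (RatFunc.C d / (RatFunc.C τ * RatFunc.X + 1)) := by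
  rw [div_eq_mul_inv, mul_comm]
  refine IsStrictlyProper.mul_isProper (Or.inr ?_) (IsProper.C d)
  have : (RatFunc.C τ * RatFunc.X + 1 : RatFunc ℝ) =
      algebraMap _ _ (Polynomial.C τ * Polynomial.X + Polynomial.C 1) := by simp
  rw [RatFunc.intDegree_inv, this, RatFunc.intDegree_polynomial,
    Polynomial.natDegree_linear hτ]
  simp

lemma isProper_deviceInverse_inv (x : Fin n × Fin 2) : IsProper (deviceInverse dp dq τp τq x)⁻¹ := by
  obtain ⟨i, a⟩ := x
  fin_cases a
  · exact lag_eq_inv (dp i) (τp i) ▸ isProper_lag (dp i) (τp i)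
  · exact lag_eq_inv (dq i) (τq i) ▸ isProper_lag (dq i) (τq i)

end Device

/-! ### The network dynamics -/

section Network

variable {n : ℕ} {ω₀ ρ : ℝ} {b : Fin n → Fin n → ℝ} {v : Fin n → ℝ}

lemma isStrictlyProper_lineGain_mul_X (hω₀ : ω₀ ≠ 0) :
    IsStrictlyProper (lineGain ω₀ ρ * (RatFunc.X / RatFunc.C ω₀)) := by
  have e : (1 + (RatFunc.C ρ + RatFunc.X / RatFunc.C ω₀) ^ 2 : RatFunc ℝ) =
      algebraMap _ _ (Polynomial.C 1 +
        (Polynomial.C (1 / ω₀) * Polynomial.X + Polynomial.C ρ) ^ 2) := by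
    simp [div_eq_inv_mul, add_comm]
  have hd : (Polynomial.C 1 +
      (Polynomial.C (1 / ω₀) * Polynomial.X + Polynomial.C ρ) ^ 2).natDegree = 2 := by
    rw [Polynomial.natDegree_C_add, Polynomial.natDegree_pow,
      Polynomial.natDegree_linear (one_div_ne_zero hω₀)]
  have h0 : (1 + (RatFunc.C ρ + RatFunc.X / RatFunc.C ω₀) ^ 2 : RatFunc ℝ) ≠ 0 := by
    rw [e]
    refine RatFunc.algebraMap_ne_zero fun h => ?_
    rw [h] at hd
    simp at hd
  have hX : (RatFunc.X : RatFunc ℝ) ≠ 0 := RatFunc.X_ne_zero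
  have hC : (RatFunc.C ω₀ : RatFunc ℝ) ≠ 0 := by simpa using hω₀
  right
  rw [lineGain, one_div, RatFunc.intDegree_mul (inv_ne_zero h0) (div_ne_zero hX hC),
    RatFunc.intDegree_inv, e, RatFunc.intDegree_polynomial, hd, div_eq_mul_inv,
    RatFunc.intDegree_mul hX (inv_ne_zero hC), RatFunc.intDegree_inv]
  simp

lemma isStrictlyProper_X_inv : IsStrictlyProper (1 / RatFunc.X) := by
  right
  rw [one_div, RatFunc.intDegree_inv, RatFunc.intDegree_X]
  norm_num

lemma isStrictlyProper_lineGain (hω₀ : ω₀ ≠ 0) : IsStrictlyProper (lineGain ω₀ ρ) := by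
  have hC : (RatFunc.C ω₀ : RatFunc ℝ) ≠ 0 := by simpa using hω₀
  have hX : (RatFunc.X : RatFunc ℝ) ≠ 0 := RatFunc.X_ne_zero
  have h := (isStrictlyProper_lineGain_mul_X (ρ := ρ) hω₀).mul_isProper
    ((IsProper.C ω₀).mul isStrictlyProper_X_inv.isProper)
  have e : lineGain ω₀ ρ * (RatFunc.X / RatFunc.C ω₀) * (RatFunc.C ω₀ * (1 / RatFunc.X)) =
      lineGain ω₀ ρ := by field_simp
  rwa [e] at h

lemma isStrictlyProper_line_entry (hω₀ : ω₀ ≠ 0) (a : ℝ) (x y : Fin 2) :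
    IsStrictlyProper (((RatFunc.C a * lineGain ω₀ ρ) • lineMatrix ω₀) x y) := by
  have h : IsStrictlyProper (lineGain ω₀ ρ * lineMatrix ω₀ x y) := by
    fin_cases x <;> fin_cases y
    · simpa [lineMatrix] using isStrictlyProper_lineGain hω₀
    · simpa [lineMatrix] using isStrictlyProper_lineGain_mul_X hω₀
    · simpa [lineMatrix] using (isStrictlyProper_lineGain_mul_X hω₀).neg
    · simpa [lineMatrix] using isStrictlyProper_lineGain hω₀
  have := h.mul_isProper (IsProper.C a)
  rwa [Matrix.smul_apply, smul_eq_mul, mul_assoc, mul_comm]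

lemma isProper_networkBlock (hω₀ : ω₀ ≠ 0) (i j : Fin n) (x y : Fin 2) :
    IsProper (networkBlock ω₀ ρ b v i j x y) := by
  unfold networkBlock
  split_ifs
  · rw [Matrix.add_apply, Matrix.sum_apply, Matrix.sum_apply]
    refine IsProper.add (IsProper.sum fun k _ => (isStrictlyProper_line_entry hω₀ _ x y).isProper)
      (IsProper.sum fun k _ => ?_)
    rw [Matrix.smul_apply, smul_eq_mul]
    refine (IsProper.C _).mul ?_
    fin_cases x <;> fin_cases y <;> simp [IsProper.zero, IsProper.one, IsProper.one.neg]
  · exact (isStrictlyProper_line_entry hω₀ _ x y).isProper.neg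

lemma isStrictlyProper_networkBlock_zero_one (hω₀ : ω₀ ≠ 0) (i j : Fin n) :
    IsStrictlyProper (networkBlock ω₀ ρ b v i j 0 1) := by
  unfold networkBlock
  split_ifs
  · rw [Matrix.add_apply, Matrix.sum_apply, Matrix.sum_apply]
    refine IsStrictlyProper.add
      (IsStrictlyProper.sum fun k _ => isStrictlyProper_line_entry hω₀ _ 0 1)
      (IsStrictlyProper.sum fun k _ => ?_)
    simp [IsStrictlyProper.zero]
  · exact (isStrictlyProper_line_entry hω₀ _ 0 1).neg

lemma networkDynamics_apply (i j : Fin n) (a c : Fin 2) :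
    networkDynamics ω₀ ρ b v (i, a) (j, c) =
      networkBlock ω₀ ρ b v i j a c * ![1 / RatFunc.X, 1 / RatFunc.C (v j)] c := by
  rw [networkDynamics, Matrix.mul_diagonal, networkModel, Matrix.comp_apply, Matrix.of_apply]

lemma isProper_networkDynamics (hω₀ : ω₀ ≠ 0) : IsProperMatrix (networkDynamics ω₀ ρ b v) := by
  rintro ⟨i, a⟩ ⟨j, c⟩
  rw [networkDynamics_apply]
  refine (isProper_networkBlock hω₀ i j a c).mul ?_
  fin_cases c
  · exact isStrictlyProper_X_inv.isProper
  · change IsProper (1 / RatFunc.C (v j))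
    rw [one_div, ← map_inv₀]
    exact IsProper.C _

/-- The angle column carries 1/s. In the voltage column the static part has no entry in the active
row, so only the strictly proper line terms remain. -/
lemma isStrictlyProper_networkDynamics_zero (hω₀ : ω₀ ≠ 0) (i : Fin n) (x : Fin n × Fin 2) :
    IsStrictlyProper (networkDynamics ω₀ ρ b v (i, 0) x) := by
  obtain ⟨j, c⟩ := x
  rw [networkDynamics_apply]
  fin_cases c
  · change IsStrictlyProper (networkBlock ω₀ ρ b v i j 0 0 * (1 / RatFunc.X))
    rw [mul_comm]
    exact isStrictlyProper_X_inv.mul_isProper (isProper_networkBlock hω₀ i j 0 0)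
  · change IsStrictlyProper (networkBlock ω₀ ρ b v i j 0 1 * (1 / RatFunc.C (v j)))
    rw [one_div, ← map_inv₀]
    exact (isStrictlyProper_networkBlock_zero_one hω₀ i j).mul_isProper (IsProper.C _)

/-- The blocks of the network model as functions of `σ = s / ω₀`. -/
noncomputable def networkBlockValue (ρ : ℝ) (b : Fin n → Fin n → ℝ) (v : Fin n → ℝ) (σ : ℂ)
    (i j : Fin n) (x y : Fin 2) : ℂ :=
  if i = j then
    (∑ k ∈ univ.erase i, (b i k * v i ^ 2 : ℝ) * (1 / (1 + (ρ + σ) ^ 2)) *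
      (!![1, σ; -σ, 1] : Matrix (Fin 2) (Fin 2) ℂ) x y) +
    ∑ k ∈ univ.erase i, (b i k * ((v i ^ 2 - v i * v k) / (1 + ρ ^ 2)) : ℝ) *
      (!![-1, 0; 0, 1] : Matrix (Fin 2) (Fin 2) ℂ) x y
  else
    -((b i j * (v i * v j) : ℝ) * (1 / (1 + (ρ + σ) ^ 2)) *
      (!![1, σ; -σ, 1] : Matrix (Fin 2) (Fin 2) ℂ) x y)

lemma hasValue_networkBlock (hω₀ : 0 < ω₀) (hρ : 0 < ρ) {s : ℂ} (hs : 0 < s.re) (i j : Fin n)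
    (x y : Fin 2) : HasValue (networkBlock ω₀ ρ b v i j x y) s
      (networkBlockValue ρ b v (s / ω₀) i j x y) := by
  have hω : (ω₀ : ℂ) ≠ 0 := Complex.ofReal_ne_zero.2 hω₀.ne'
  have hX : HasValue (RatFunc.X / RatFunc.C ω₀) s (s / ω₀) :=
    (HasValue.X s).div (HasValue.C ω₀ s) hω
  have hd : 1 + ((ρ : ℂ) + s / ω₀) ^ 2 ≠ 0 := by
    refine lineDenom_ne_zero hρ ?_
    rw [Complex.div_ofReal_re]
    exact (div_pos hs hω₀).le
  have hG : HasValue (lineGain ω₀ ρ) s (1 / (1 + (ρ + s / ω₀) ^ 2)) :=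
    (HasValue.one s).div ((HasValue.one s).add (((HasValue.C ρ s).add hX).pow 2)) hd
  have hM : HasValue (lineMatrix ω₀ x y) s
      ((!![1, s / ω₀; -(s / ω₀), 1] : Matrix (Fin 2) (Fin 2) ℂ) x y) := by
    fin_cases x <;> fin_cases y
    · exact HasValue.one s
    · exact hX
    · exact hX.neg
    · exact HasValue.one s
  have hE : HasValue ((!![-1, 0; 0, 1] : Matrix (Fin 2) (Fin 2) (RatFunc ℝ)) x y) s
      ((!![-1, 0; 0, 1] : Matrix (Fin 2) (Fin 2) ℂ) x y) := by
    fin_cases x <;> fin_cases y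
    · exact (HasValue.one s).neg
    · exact HasValue.zero s
    · exact HasValue.zero s
    · exact HasValue.one s
  unfold networkBlock networkBlockValue
  split_ifs
  · rw [Matrix.add_apply, Matrix.sum_apply, Matrix.sum_apply]
    exact (HasValue.sum fun k _ => ((HasValue.C _ s).mul hG).mul hM).add
      (HasValue.sum fun k _ => (HasValue.C _ s).mul hE)
  · exact (((HasValue.C _ s).mul hG).mul hM).neg

lemma hasValue_networkDynamics (hω₀ : 0 < ω₀) (hρ : 0 < ρ) (hv : ∀ i, 0 < v i) {s : ℂ}
    (hs : 0 < s.re) (i j : Fin n) (a c : Fin 2) :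
    HasValue (networkDynamics ω₀ ρ b v (i, a) (j, c)) s
      (networkBlockValue ρ b v (s / ω₀) i j a c * ![1 / s, 1 / (v j : ℂ)] c) := by
  rw [networkDynamics_apply]
  refine (hasValue_networkBlock hω₀ hρ hs i j a c).mul ?_
  have hs0 : s ≠ 0 := by rintro rfl; simp at hs
  fin_cases c
  · exact (HasValue.one s).div (HasValue.X s) hs0
  · exact (HasValue.one s).div (HasValue.C _ s) (Complex.ofReal_ne_zero.2 (hv j).ne')

lemma sum_networkBlockValue_active (σ : ℂ) (p q : Fin n → ℂ) (i : Fin n) :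
    ∑ j, (networkBlockValue ρ b v σ i j 0 0 * p j + networkBlockValue ρ b v σ i j 0 1 * q j) =
      activeFlow ρ (lineWeight b) v σ p q i := by
  rw [← add_sum_erase univ _ (mem_univ i), activeFlow]
  simp_rw [mul_assoc ((lineWeight b i _ : ℝ) : ℂ)]
  rw [sum_lineWeight_mul, sum_lineWeight_mul, mul_sum, mul_sum, ← sum_sub_distrib]
  simp only [networkBlockValue, if_true, sum_mul, ← sum_add_distrib]
  refine sum_congr rfl fun j hj => ?_
  rw [if_neg (ne_of_mem_erase hj).symm, if_neg (ne_of_mem_erase hj).symm]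
  simp only [Matrix.of_apply, Matrix.cons_val', Matrix.cons_val_zero, Matrix.cons_val_one,
    Matrix.cons_val_fin_one]
  push_cast
  ring

lemma sum_networkBlockValue_reactive (σ : ℂ) (p q : Fin n → ℂ) (i : Fin n) :
    ∑ j, (networkBlockValue ρ b v σ i j 1 0 * p j + networkBlockValue ρ b v σ i j 1 1 * q j) =
      reactiveFlow ρ (lineWeight b) v σ p q i := by
  rw [← add_sum_erase univ _ (mem_univ i), reactiveFlow]
  simp_rw [mul_assoc ((lineWeight b i _ : ℝ) : ℂ)]
  rw [sum_lineWeight_mul, sum_lineWeight_mul, mul_sum, mul_sum, ← sum_add_distrib]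
  simp only [networkBlockValue, if_true, sum_mul, ← sum_add_distrib]
  refine sum_congr rfl fun j hj => ?_
  rw [if_neg (ne_of_mem_erase hj).symm, if_neg (ne_of_mem_erase hj).symm]
  simp only [Matrix.of_apply, Matrix.cons_val', Matrix.cons_val_zero, Matrix.cons_val_one,
    Matrix.cons_val_fin_one]
  push_cast
  ring

end Network

/-! ### The closed loop -/

section ClosedLoop

variable {n : ℕ} {ω₀ ρ vmax : ℝ} {b : Fin n → Fin n → ℝ} {v dp dq τp τq : Fin n → ℝ}

/-- A solution of `(D₀⁻¹ + N₀) T = I` has all its poles in the open left half plane. -/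
lemma hasStablePoles_of_admittance_mul_eq_one (hω₀ : 0 < ω₀) (hρ : 0 < ρ)
    (hb_symm : ∀ i j, b i j = b j i) (hb_nonneg : ∀ i j, 0 ≤ b i j)
    (hv_pos : ∀ i, 0 < v i) (hv_le : ∀ i, v i ≤ vmax) (hvmax : vmax ≤ 11 / 10)
    (hdp : ∀ i, 0 < dp i) (hdq : ∀ i, 0 < dq i) (hτp : ∀ i, 0 ≤ τp i)
    (hp : ∀ i, ActivePowerConditions ρ
      (dp i / ω₀ * vmax ^ 2 * selfSusceptance b i) (τp i * ω₀))
    (hq : ∀ i, ReactivePowerConditions ρ vmax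
      (dq i / v i * selfSusceptance b i) (τq i * ω₀))
    {T : Matrix (Fin n × Fin 2) (Fin n × Fin 2) (RatFunc ℝ)}
    (hT : (Matrix.diagonal (deviceInverse dp dq τp τq) + networkDynamics ω₀ ρ b v) * T = 1)
    (x k : Fin n × Fin 2) : HasStablePoles (T x k) := by
  obtain ⟨K, hK⟩ := exists_response_bound hω₀ hρ hb_symm hb_nonneg hv_pos hv_le hvmax hdp hdq hτp
    hp hq
  intro s₀ hs₀
  by_contra! hre
  -- A pole with Re s₀ ≥ 0 is approached along s₀ + t, where Re s ≥ t > 0. Only finitely many points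
  -- are poles of the column, so it can be evaluated for all small t.
  refine denom_ne_zero_of_bound (K := K) ?_ hs₀
  have hray : Tendsto (fun t : ℝ => s₀ + t) (𝓝[>] 0) (𝓝[≠] s₀) := by
    refine tendsto_nhdsWithin_iff.2 ⟨?_, ?_⟩
    · have : Continuous fun t : ℝ => s₀ + t := by fun_prop
      exact (this.tendsto' 0 _ (by simp)).mono_left nhdsWithin_le_nhds
    · filter_upwards [self_mem_nhdsWithin] with t ht
      simpa using (ne_of_gt ht : t ≠ 0)
  have hne : ∀ᶠ t : ℝ in 𝓝[>] 0, ∀ z, Polynomial.aeval (s₀ + t) (T z k).denom ≠ 0 :=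
    eventually_all.2 fun z =>
      hray.eventually ((nhdsNE_le_cofinite s₀) (eventually_denom_ne_zero (T z k)))
  have h1 : ∀ᶠ t : ℝ in 𝓝[>] 0, t ≤ 1 := nhdsWithin_le_nhds (Iic_mem_nhds one_pos)
  filter_upwards [hne, h1, self_mem_nhdsWithin] with t ht ht1 ht0
  have ht0 : 0 < t := ht0
  set s : ℂ := s₀ + t with hs_def
  have hts : t ≤ s.re := by simpa [hs_def] using hre
  have hs : 0 < s.re := ht0.trans_le hts
  have hs0 : s ≠ 0 := by rintro h; simp [h] at hs
  set y : Fin n × Fin 2 → ℂ :=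
    fun z => Polynomial.aeval s (T z k).num / Polynomial.aeval s (T z k).denom with hy
  have hyv : ∀ z, HasValue (T z k) s (y z) := fun z => hasValue_of_denom_ne_zero (ht z)
  have hrow : ∀ z : Fin n × Fin 2, deviceInverse dp dq τp τq z * T z k +
      ∑ j, (networkDynamics ω₀ ρ b v z (j, 0) * T (j, 0) k +
        networkDynamics ω₀ ρ b v z (j, 1) * T (j, 1) k) = if z = k then 1 else 0 := by
    intro z
    have := congrFun (congrFun hT z) k
    rw [Matrix.add_mul, Matrix.add_apply, Matrix.diagonal_mul, Matrix.mul_apply,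
      Fintype.sum_prod_type, Matrix.one_apply] at this
    simpa only [Fin.sum_univ_two] using this
  have hone : ∀ z, HasValue (if z = k then 1 else 0) s (if z = k then 1 else 0) := by
    intro z
    split_ifs
    · exact HasValue.one s
    · exact HasValue.zero s
  have hN := fun i j a c => hasValue_networkDynamics (b := b) hω₀ hρ hv_pos hs i j a c
  have hsum : ∀ (i : Fin n) (a : Fin 2),
      HasValue (∑ j, (networkDynamics ω₀ ρ b v (i, a) (j, 0) * T (j, 0) k +
          networkDynamics ω₀ ρ b v (i, a) (j, 1) * T (j, 1) k)) s
        (1 / s * ∑ j, (networkBlockValue ρ b v (s / ω₀) i j a 0 * y (j, 0) +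
          networkBlockValue ρ b v (s / ω₀) i j a 1 * (s / v j * y (j, 1)))) := by
    intro i a
    refine (HasValue.sum fun j _ => ((hN i j a 0).mul (hyv (j, 0))).add
      ((hN i j a 1).mul (hyv (j, 1)))).congr_value ?_
    rw [mul_sum]
    refine sum_congr rfl fun j _ => ?_
    simp only [Matrix.cons_val_zero, Matrix.cons_val_one]
    have : (v j : ℂ) ≠ 0 := Complex.ofReal_ne_zero.2 (hv_pos j).ne'
    field_simp
  refine hK s t ht0 ht1 hts y (fun z => if z = k then 1 else 0) k (fun _ => rfl) ?_ ?_ x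
  · intro i
    rw [← sum_networkBlockValue_active]
    refine HasValue.unique ?_ (hone (i, 0))
    rw [← hrow (i, 0)]
    exact ((hasValue_lagInverse _ _ s).mul (hyv (i, 0))).add (hsum i 0)
  · intro i
    rw [← sum_networkBlockValue_reactive]
    refine HasValue.unique ?_ (hone (i, 1))
    rw [← hrow (i, 1)]
    exact ((hasValue_lagInverse _ _ s).mul (hyv (i, 1))).add (hsum i 1)

end ClosedLoop

/-! ### Inversion over the proper rational functions -/

section Proper

variable {ι κ μ : Type*} [Fintype κ] {A : Matrix ι κ (RatFunc ℝ)} {B : Matrix κ μ (RatFunc ℝ)}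

lemma IsProperMatrix.mul (hA : IsProperMatrix A) (hB : IsProperMatrix B) :
    IsProperMatrix (A * B) := fun i j =>
  IsProper.sum fun k _ => (hA i k).mul (hB k j)

/-- If the loop transfer matrix is strictly proper, then the return difference is invertible over
the proper rational functions. -/
lemma isProperMatrix_one_add_inv {ι : Type*} [Fintype ι] [DecidableEq ι]
    {E : Matrix ι ι (RatFunc ℝ)} (hE : ∀ i j, IsStrictlyProper (E i j)) :
    IsUnit (1 + E).det ∧ IsProperMatrix (1 + E)⁻¹ := by
  have hu : IsUnit (1 + E).det := by
    rw [isUnit_iff_ne_zero]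
    intro h0
    obtain ⟨x, hx, h⟩ := Matrix.exists_mulVec_eq_zero_iff.2 h0
    refine hx (eq_zero_of_fixed_point hE fun i => ?_)
    rw [Matrix.add_mulVec, Matrix.one_mulVec] at h
    exact eq_neg_of_add_eq_zero_left (congrFun h i)
  refine ⟨hu, fun i j => ?_⟩
  have h := Matrix.mul_nonsing_inv (1 + E) hu
  refine isProper_of_fixed_point hE (x := fun i => (1 + E)⁻¹ i j)
    (y := fun i => (1 : Matrix ι ι (RatFunc ℝ)) i j) (fun i => ?_) (fun i => ?_) i
  · rw [Matrix.one_apply]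
    split_ifs
    · exact IsProper.one
    · exact IsProper.zero
  · have hi := congrFun (congrFun h i) j
    rw [Matrix.add_mul, Matrix.one_mul, Matrix.add_apply, Matrix.mul_apply] at hi
    exact eq_sub_of_add_eq hi

end Proper

end GridForming

/-! ### Internal stability of the closed loop -/

theorem theorem2 (n : ℕ) (ω₀ ρ vmax : ℝ) (b : Fin n → Fin n → ℝ) (v : Fin n → ℝ)
    (dp dq τp τq : Fin n → ℝ)
    (hω₀ : 0 < ω₀) (hρ : 0 < ρ)
    (hb_symm : ∀ i j, b i j = b j i) (hb_nonneg : ∀ i j, 0 ≤ b i j)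
    (hv_pos : ∀ i, 0 < v i) (hv_le : ∀ i, v i ≤ vmax) (hvmax : vmax ≤ 11 / 10)
    (hdp : ∀ i, 0 < dp i) (hdq : ∀ i, 0 < dq i)
    (hτp : ∀ i, 0 ≤ τp i) (hτq : ∀ i, 0 ≤ τq i)
    (hp : ∀ i, GridForming.ActivePowerConditions ρ
      (dp i / ω₀ * vmax ^ 2 * GridForming.selfSusceptance b i) (τp i * ω₀))
    (hq : ∀ i, GridForming.ReactivePowerConditions ρ vmax
      (dq i / v i * GridForming.selfSusceptance b i) (τq i * ω₀)) :
    GridForming.InternallyFeedbackStable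
      (GridForming.deviceDynamics dp dq τp τq)
      (GridForming.networkDynamics ω₀ ρ b v) := by
  open GridForming in
  have hτq' : ∀ i, τq i ≠ 0 := fun i => by
    have h := (hq i).time_constant_pos hρ ((hv_pos i).trans_le (hv_le i))
      (mul_nonneg (div_pos (hdq i) (hv_pos i)).le (Finset.sum_nonneg fun j _ => hb_nonneg i j))
    exact (pos_of_mul_pos_left h hω₀.le).ne'
  rw [deviceDynamics_eq]
  set δ := deviceInverse dp dq τp τq with hδ
  have hδ0 : ∀ x, δ x ≠ 0 := deviceInverse_ne_zero hdp hdq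
  set N := networkDynamics ω₀ ρ b v with hN
  set D : Matrix (Fin n × Fin 2) (Fin n × Fin 2) (RatFunc ℝ) :=
    Matrix.diagonal fun x => (δ x)⁻¹ with hD
  have hDp : IsProperMatrix D := by
    intro x y
    rw [hD, Matrix.diagonal_apply]
    split_ifs
    · exact isProper_deviceInverse_inv x
    · exact IsProper.zero
  have hNp : IsProperMatrix N := isProper_networkDynamics hω₀.ne'
  -- In the active rows the network supplies the strict properness. In the reactive rows the static
  -- part of the network is merely proper, and the lag with τ_q ≠ 0 supplies it.
  have hE : ∀ x y, IsStrictlyProper ((D * N) x y) := by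
    rintro ⟨i, a⟩ y
    rw [hD, Matrix.diagonal_mul]
    fin_cases a
    · rw [mul_comm]
      exact (isStrictlyProper_networkDynamics_zero hω₀.ne' i y).mul_isProper
        (isProper_deviceInverse_inv _)
    · refine IsStrictlyProper.mul_isProper ?_ (hNp _ y)
      exact lag_eq_inv (dq i) (τq i) ▸ isStrictlyProper_lag (dq i) (hτq' i)
  obtain ⟨hu, hXp⟩ := isProperMatrix_one_add_inv hE
  set X := (1 + D * N)⁻¹ with hX
  have hBX : (1 + D * N) * X = 1 := Matrix.mul_nonsing_inv _ hu
  have hXB : X * (1 + D * N) = 1 := Matrix.nonsing_inv_mul _ hu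
  set Δ : Matrix (Fin n × Fin 2) (Fin n × Fin 2) (RatFunc ℝ) := Matrix.diagonal δ with hΔ
  have hΔD : Δ * D = 1 := by
    rw [hΔ, hD, Matrix.diagonal_mul_diagonal, ← Matrix.diagonal_one]
    exact congrArg _ (funext fun x => mul_inv_cancel₀ (hδ0 x))
  have hDΔ : D * Δ = 1 := mul_eq_one_comm.1 hΔD
  have hT : (Δ + N) * (X * D) = 1 := by
    have e : Δ + N = Δ * (1 + D * N) := by
      rw [Matrix.mul_add, Matrix.mul_one, ← Matrix.mul_assoc, hΔD, Matrix.one_mul]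
    rw [e, Matrix.mul_assoc, ← Matrix.mul_assoc (1 + D * N), hBX, Matrix.one_mul, hΔD]
  have hTs : ∀ x y, HasStablePoles ((X * D) x y) :=
    hasStablePoles_of_admittance_mul_eq_one hω₀ hρ hb_symm hb_nonneg hv_pos hv_le hvmax hdp hdq
      hτp hp hq hT
  have hδs : ∀ x, HasStablePoles (δ x) := fun x => HasStablePoles.polynomial _
  have hones : ∀ x y, HasStablePoles ((1 : Matrix (Fin n × Fin 2) (Fin n × Fin 2) _) x y) := by
    intro x y
    rw [Matrix.one_apply]
    split_ifs
    · exact HasStablePoles.one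
    · exact HasStablePoles.zero
  -- Multiplying by the polynomial matrix Δ adds no poles. The network matrix, which has 1/s in its
  -- entries, is never used as a factor for stability; it is eliminated through `hXB` and `hT`.
  have hXs : ∀ x y, HasStablePoles (X x y) := by
    intro x y
    have e : X = X * D * Δ := by rw [Matrix.mul_assoc, hDΔ, Matrix.mul_one]
    rw [e, hΔ, Matrix.mul_diagonal]
    exact (hTs x y).mul (hδs y)
  have e₂ : -(X * D * N) = X + -1 := by
    rw [Matrix.mul_add, Matrix.mul_one, ← Matrix.mul_assoc] at hXB
    rw [← hXB]
    abel
  have e₃ : N * X * D = 1 + -(Δ * (X * D)) := by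
    rw [Matrix.add_mul, ← Matrix.mul_assoc N] at hT
    rw [← hT]
    abel
  have hs₃ : ∀ x y, HasStablePoles ((N * X * D) x y) := by
    intro x y
    rw [e₃, hΔ, Matrix.add_apply, Matrix.neg_apply, Matrix.diagonal_mul]
    exact (hones x y).add ((hδs x).mul (hTs x y)).neg
  refine ⟨hDp, hNp, hu, ?_⟩
  rintro (x | x) (y | y)
  · exact ⟨(hXp.mul hDp) x y, hTs x y⟩
  · refine ⟨(((hXp.mul hDp).mul hNp) x y).neg, ?_⟩
    change HasStablePoles ((-(X * D * N)) x y)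
    rw [e₂]
    exact (hXs x y).add (hones x y).neg
  · exact ⟨((hNp.mul hXp).mul hDp) x y, hs₃ x y⟩
  · refine ⟨(hNp.mul hXp) x y, ?_⟩
    change HasStablePoles ((N * X) x y)
    have e : N * X = N * X * D * Δ := by rw [Matrix.mul_assoc, hDΔ, Matrix.mul_one]
    rw [e, hΔ, Matrix.mul_diagonal]
    exact (hs₃ x y).mul (hδs y)
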